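/- For a finite group $G$ let $G$ act trivially on $\mathbb{C}^\times$, and for a $2$-cocycle $\alpha\in Z^2(G,\mathbb{C}^\times)$ let $[\alpha]$ be its class in $H^2(G,\mathbb{C}^\times)$ and let $\mathbb{C}^\alpha G$ be the twisted group algebra, i.e. the complex algebra with basis $(u_g)_{g\in G}$ and multiplication $u_g u_h=\alpha(g,h)u_{gh}$; up to isomorphism it depends only on $[\alpha]$. Write $G\sim_{\mathbb{C}}H$ if there is a group isomorphism $\psi\colon H^2(G,\mathbb{C}^\times)\to H^2(H,\mathbb{C}^\times)$ such that $\mathbb{C}^\alpha G\cong\mathbb{C}^\beta H$ as $\mathbb{C}$-algebras whenever $\psi([\alpha])=[\beta]$. The equivalence classes of $\sim_{\mathbb{C}}$ on the groups of a given order are called $\mathbb{C}$-twist isomorphism classes. A non-abelian group $G$ of order $p^n$ ($p$ prime) has generalized corank $s(G)$ if $|H^2(G,\mathbb{C}^\times)|=p^{\frac{(n-1)(n-2)}{2}+1-s(G)}$. Lemma. Let $p$ be a prime and let $G$ be a non-abelian group of order $p^n$ with $s(G)\in\{0,1\}$. Then the $\mathbb{C}$-twist isomorphism class of $G$ consists of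 a single group up to isomorphism: for every group $H$ of order $p^n$, $G\sim_{\mathbb{C}}H$ if and only if $G\cong H$. -/

import Mathlib

noncomputable section

/-- The unit group `Rˣ`, written additively, as a trivial `G`-module. -/
abbrev unitsRep (R G : Type) [CommRing R] [Group G] : Rep ℤ G :=
  Rep.trivial ℤ G (Additive Rˣ)

/-- The group `Z²(G, Rˣ)` of 2-cocycles for the trivial action of `G` on `Rˣ`. -/
abbrev TwoCocycle (R G : Type) [CommRing R] [Group G] : Type :=
  groupCohomology.cocycles₂ (unitsRep R G)

/-- The second cohomology group `H²(G, Rˣ)` for the trivial action of `G` on `Rˣ`. It is written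
additively; for `R = ℂ` it is the Schur multiplier of `G`. -/
abbrev SecondCohomology (R G : Type) [CommRing R] [Group G] : Type :=
  groupCohomology.H2 (unitsRep R G)

namespace TwoCocycle

variable {R G : Type} [CommRing R] [Group G]

/-- The value `α(g, h) ∈ Rˣ` of a 2-cocycle. -/
def val (α : TwoCocycle R G) (g h : G) : Rˣ := Additive.toMul (α (g, h))

/-- The cohomology class `[α]` of a 2-cocycle. -/
def cohomologyClass (α : TwoCocycle R G) : SecondCohomology R G :=
  (groupCohomology.H2π (unitsRep R G)).hom α

theorem val_mul_val (α : TwoCocycle R G) (g h j : G) :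
    α.val (g * h) j * α.val g h = α.val h j * α.val g (h * j) :=
  (groupCohomology.mem_cocycles₂_iff (A := unitsRep R G) α).1 α.2 g h j

theorem val_one_left (α : TwoCocycle R G) (g : G) : α.val 1 g = α.val 1 1 :=
  groupCohomology.cocycles₂_map_one_fst (A := unitsRep R G) α g

theorem val_one_right (α : TwoCocycle R G) (g : G) : α.val g 1 = α.val 1 1 :=
  groupCohomology.cocycles₂_map_one_snd (A := unitsRep R G) α g

end TwoCocycle

/-- The twisted group algebra `R^α G`: the free `R`-module on symbols `u_g`, `g ∈ G`, with
multiplication the `R`-bilinear extension of `u_g * u_h = α(g, h) u_{gh}`. -/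
def TwistedGroupAlgebra {R G : Type} [CommRing R] [Group G] (_α : TwoCocycle R G) : Type :=
  G →₀ R

namespace TwistedGroupAlgebra

variable {R G : Type} [CommRing R] [Group G] (α : TwoCocycle R G)

instance : AddCommGroup (TwistedGroupAlgebra α) := inferInstanceAs (AddCommGroup (G →₀ R))

instance : Module R (TwistedGroupAlgebra α) := inferInstanceAs (Module R (G →₀ R))

/-- The basis `(u_g)` of `R^α G`. -/
def basis : Module.Basis G R (TwistedGroupAlgebra α) :=
  Module.Basis.ofRepr (LinearEquiv.refl R (G →₀ R))

/-- The multiplication of `R^α G` as a bilinear map. -/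
def mulLin : TwistedGroupAlgebra α →ₗ[R] TwistedGroupAlgebra α →ₗ[R] TwistedGroupAlgebra α :=
  (basis α).constr R fun g => (basis α).constr R fun h => (α.val g h : R) • basis α (g * h)

instance : Mul (TwistedGroupAlgebra α) := ⟨fun x y => mulLin α x y⟩

/-- The identity of `R^α G` is `α(1, 1)⁻¹ u_1`. -/
instance : One (TwistedGroupAlgebra α) := ⟨((α.val 1 1)⁻¹ : Rˣ) • basis α 1⟩

theorem mul_def (x y : TwistedGroupAlgebra α) : x * y = mulLin α x y := rfl

theorem one_def : (1 : TwistedGroupAlgebra α) = (((α.val 1 1)⁻¹ : Rˣ) : R) • basis α 1 := rfl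

theorem mulLin_basis (g h : G) :
    mulLin α (basis α g) (basis α h) = (α.val g h : R) • basis α (g * h) := by
  simp [mulLin]

theorem basis_mul_basis (g h : G) :
    basis α g * basis α h = (α.val g h : R) • basis α (g * h) :=
  mulLin_basis α g h

theorem mulLin_assoc (x y z : TwistedGroupAlgebra α) :
    mulLin α (mulLin α x y) z = mulLin α x (mulLin α y z) := by
  have h1 (g h : G) : (mulLin α) (mulLin α (basis α g) (basis α h)) =
      mulLin α (basis α g) ∘ₗ mulLin α (basis α h) := (basis α).ext fun j => by
    have := congrArg (Units.val) (α.val_mul_val g h j)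
    simp only [Units.val_mul] at this
    simp only [LinearMap.comp_apply, mulLin_basis, map_smul, LinearMap.smul_apply, smul_smul,
      mul_assoc g h j]
    rw [mul_comm, this]
  have h2 (g : G) : (mulLin α) ∘ₗ (mulLin α (basis α g)) =
      (LinearMap.llcomp R _ _ _ (mulLin α (basis α g))) ∘ₗ mulLin α := (basis α).ext fun h => h1 g h
  have h3 : ((mulLin α).flip z) ∘ₗ ((mulLin α).flip y) = (mulLin α).flip (mulLin α y z) :=
    (basis α).ext fun g => LinearMap.congr_fun (LinearMap.congr_fun (h2 g) y) z
  exact LinearMap.congr_fun h3 x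

instance : Ring (TwistedGroupAlgebra α) :=
  { (inferInstance : AddCommGroup (TwistedGroupAlgebra α)) with
    mul := (· * ·)
    one := 1
    left_distrib := fun x y z => by simp [mul_def]
    right_distrib := fun x y z => by simp [mul_def]
    zero_mul := fun x => by simp [mul_def]
    mul_zero := fun x => by simp [mul_def]
    mul_assoc := fun x y z => mulLin_assoc α x y z
    one_mul := fun x => by
      have h : mulLin α 1 = LinearMap.id := (basis α).ext fun g => by
        simp [one_def, mulLin_basis, α.val_one_left g, smul_smul]
      simp [mul_def, h]
    mul_one := fun x => by
      have h : (mulLin α).flip 1 = LinearMap.id := (basis α).ext fun g => by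
        simp [one_def, mulLin_basis, α.val_one_right g, smul_smul]
      exact LinearMap.congr_fun h x }

instance : Algebra R (TwistedGroupAlgebra α) :=
  Algebra.ofModule (fun r x y => by simp [mul_def]) (fun r x y => by simp [mul_def])

end TwistedGroupAlgebra

/-- `G ∼_R H`: there is a group isomorphism `ψ : H²(G, Rˣ) → H²(H, Rˣ)` such that `R^α G` and
`R^β H` are isomorphic `R`-algebras whenever `ψ [α] = [β]`. -/
def TwistIsomorphic (R G H : Type) [CommRing R] [Group G] [Group H] : Prop :=
  ∃ ψ : SecondCohomology R G ≃+ SecondCohomology R H,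
    ∀ (α : TwoCocycle R G) (β : TwoCocycle R H),
      ψ α.cohomologyClass = β.cohomologyClass →
        Nonempty (TwistedGroupAlgebra α ≃ₐ[R] TwistedGroupAlgebra β)

/-- A group `G` of order `p ^ n` has generalized corank `s` if
`|H²(G, ℂˣ)| = p ^ ((n - 1) (n - 2) / 2 + 1 - s)`. The exponent is an integer, and the division
by two is exact. -/
def HasGeneralizedCorank (p n : ℕ) (G : Type) [Group G] (s : ℤ) : Prop :=
  (Nat.card (SecondCohomology ℂ G) : ℚ) =
    (p : ℚ) ^ (((n : ℤ) - 1) * ((n : ℤ) - 2) / 2 + 1 - s)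

end

/-!
A central element `z ∈ G'` of order `p` and a class `[α]` in `H²(G, Kˣ)` determine the character
`g ↦ α(g, z) / α(z, g)` of `G`. If it is trivial, `[α]` is inflated from `G / ⟨z⟩`, and the classes
on `G / ⟨z⟩` that become trivial on `G` form a group of order `p`. By induction on `|G'|`, a
nonabelian group of order `p ^ n` satisfies `|G'| |H²(G, Kˣ)| ≤ p ^ ((n - 1) (n - 2) / 2 + 2)`.
So a large `H²` forces `|G'| ≤ p ^ 2`, and then `G` has so many of these characters that the
identities they satisfy determine `G` up to isomorphism: for given `n`, at most one group has
`|G'| = p` and at most one has `|G'| = p ^ 2`. Twist isomorphism preserves `|H²|` and also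
`|G : G'|`, the number of algebra homomorphisms from the untwisted group algebra to `K`.
-/

open Subgroup
open scoped commutatorElement

noncomputable section

namespace TwoCocycle

variable {R G H : Type} [CommRing R] [Group G] [Group H]

theorem ext_val {α β : TwoCocycle R G} (h : ∀ g k, α.val g k = β.val g k) : α = β :=
  groupCohomology.cocycles₂_ext h

@[simp] theorem val_zero (g h : G) : (0 : TwoCocycle R G).val g h = 1 := rfl

@[simp] theorem val_add (α β : TwoCocycle R G) (g h : G) :
    (α + β).val g h = α.val g h * β.val g h := rfl

@[simp] theorem val_sub (α β : TwoCocycle R G) (g h : G) :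
    (α - β).val g h = α.val g h / β.val g h := rfl

/-- The 2-cocycle with given values. -/
def ofVal (f : G → G → Rˣ) (hf : ∀ g h j, f (g * h) j * f g h = f h j * f g (h * j)) :
    TwoCocycle R G :=
  ⟨fun q => Additive.ofMul (f q.1 q.2),
    (groupCohomology.mem_cocycles₂_iff (A := unitsRep R G) _).2 hf⟩

/-- The coboundary `(g, h) ↦ l(g) l(h) / l(gh)` of a 1-cochain `l`. -/
def coboundary (l : G → Rˣ) : TwoCocycle R G :=
  ofVal (fun g h => l g * l h / l (g * h)) fun g h j => by
    rw [div_mul_div_comm, div_mul_div_comm, div_eq_div_iff_mul_eq_mul, mul_assoc g h j]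
    simp only [mul_comm, mul_left_comm]

@[simp] theorem val_coboundary (l : G → Rˣ) (g h : G) :
    (coboundary l).val g h = l g * l h / l (g * h) := rfl

/-- The pullback of cocycles along a group homomorphism. -/
def comap (f : G →* H) : TwoCocycle R H →+ TwoCocycle R G where
  toFun α := ofVal (fun g h => α.val (f g) (f h)) fun g h j => by
    simpa only [map_mul] using α.val_mul_val (f g) (f h) (f j)
  map_zero' := rfl
  map_add' _ _ := rfl

@[simp] theorem val_comap (f : G →* H) (α : TwoCocycle R H) (g h : G) :
    (comap f α).val g h = α.val (f g) (f h) := rfl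

theorem exists_comap_mk'_eq {N : Subgroup G} [N.Normal] (γ : TwoCocycle R G)
    (hγ : ∀ g h, ∀ m ∈ N, ∀ n ∈ N, γ.val (g * m) (h * n) = γ.val g h) :
    ∃ β : TwoCocycle R (G ⧸ N), comap (QuotientGroup.mk' N) β = γ := by
  have val_out (g h : G) : γ.val (g : G ⧸ N).out (h : G ⧸ N).out = γ.val g h := by
    obtain ⟨m, hm⟩ := QuotientGroup.mk_out_eq_mul N g
    obtain ⟨n, hn⟩ := QuotientGroup.mk_out_eq_mul N h
    rw [hm, hn, hγ _ _ _ m.2 _ n.2]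
  refine ⟨ofVal (fun q r => γ.val q.out r.out) fun q r t => ?_, ext_val val_out⟩
  induction q using QuotientGroup.induction_on
  induction r using QuotientGroup.induction_on
  induction t using QuotientGroup.induction_on
  simp only [← QuotientGroup.mk_mul, val_out]
  exact γ.val_mul_val _ _ _

/-- The group homomorphism `α ↦ [α]`. -/
def cohomologyClassHom : TwoCocycle R G →+ SecondCohomology R G :=
  (groupCohomology.H2π (unitsRep R G)).hom.toAddMonoidHom

@[simp] theorem cohomologyClassHom_apply (α : TwoCocycle R G) :
    cohomologyClassHom α = α.cohomologyClass := rfl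

theorem cohomologyClass_surjective :
    Function.Surjective (cohomologyClass : TwoCocycle R G → SecondCohomology R G) :=
  (ModuleCat.epi_iff_surjective (groupCohomology.H2π (unitsRep R G))).mp inferInstance

theorem cohomologyClass_eq_zero_iff {α : TwoCocycle R G} :
    α.cohomologyClass = 0 ↔ ∃ l : G → Rˣ, coboundary l = α := by
  refine (groupCohomology.H2π_eq_zero_iff (A := unitsRep R G) α).trans
    ⟨fun ⟨l, hl⟩ => ⟨fun g => (l g).toMul, ext_val fun g h => ?_⟩,
      fun ⟨l, hl⟩ => ⟨fun g => Additive.ofMul (l g), funext fun q => ?_⟩⟩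
  · exact (mul_div_assoc _ _ _).trans
      ((mul_comm _ _).trans (congrArg Additive.toMul (congrFun hl (g, h))))
  · rw [← hl]
    exact congrArg Additive.ofMul ((mul_comm _ _).trans (mul_div_assoc _ _ _).symm)

theorem cohomologyClass_eq_iff {α β : TwoCocycle R G} :
    α.cohomologyClass = β.cohomologyClass ↔ ∃ l : G → Rˣ, coboundary l = α - β := by
  rw [← cohomologyClass_eq_zero_iff, ← cohomologyClassHom_apply (α - β),
    cohomologyClassHom.map_sub]
  exact sub_eq_zero.symm

end TwoCocycle

namespace SecondCohomology

open TwoCocycle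

variable {R G H : Type} [CommRing R] [Group G] [Group H]

/-- The homomorphism on `H²(G, Rˣ)` induced by a homomorphism on cocycles that kills all
coboundaries. -/
def lift {M : Type*} [AddGroup M] (F : TwoCocycle R G →+ M) (hF : ∀ l, F (coboundary l) = 0) :
    SecondCohomology R G →+ M :=
  cohomologyClassHom.liftOfSurjective cohomologyClass_surjective ⟨F, fun α hα => by
    obtain ⟨l, rfl⟩ := cohomologyClass_eq_zero_iff.mp hα
    exact hF l⟩

@[simp] theorem lift_cohomologyClass {M : Type*} [AddGroup M] (F : TwoCocycle R G →+ M)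
    (hF : ∀ l, F (coboundary l) = 0) (α : TwoCocycle R G) : lift F hF α.cohomologyClass = F α :=
  cohomologyClassHom.liftOfRightInverse_comp_apply _ _ _ α

/-- Pullback in degree two along a group homomorphism; for a projection `G → G ⧸ N` this is
inflation. -/
def comap (f : G →* H) : SecondCohomology R H →+ SecondCohomology R G :=
  lift (cohomologyClassHom.comp (TwoCocycle.comap f)) fun l =>
    cohomologyClass_eq_zero_iff.mpr ⟨l ∘ f, ext_val fun g h => by simp⟩

@[simp] theorem comap_cohomologyClass (f : G →* H) (α : TwoCocycle R H) :
    comap f α.cohomologyClass = (TwoCocycle.comap f α).cohomologyClass :=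
  lift_cohomologyClass _ _ α

theorem comap_comap_symm (f : G ≃* H) (q : SecondCohomology R G) :
    comap f.toMonoidHom (comap f.symm.toMonoidHom q) = q := by
  obtain ⟨α, rfl⟩ := cohomologyClass_surjective q
  rw [comap_cohomologyClass, comap_cohomologyClass]
  exact congrArg _ (ext_val fun g h => by simp)

/-- The isomorphism `H²(G, Rˣ) ≃ H²(H, Rˣ)` induced by a group isomorphism. -/
def congr (f : G ≃* H) : SecondCohomology R G ≃+ SecondCohomology R H where
  __ := comap f.symm.toMonoidHom
  invFun := comap f.toMonoidHom
  left_inv := comap_comap_symm f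
  right_inv := comap_comap_symm f.symm

end SecondCohomology

namespace TwoCocycle

variable {R G : Type} [CommRing R] [Group G]

/-- The commutator pairing `α(g, h) / α(h, g)` of commuting elements `g` and `h`: the scalar
`⁅u_g, u_h⁆` of the twisted group algebra. -/
def commPairing (α : TwoCocycle R G) (g h : G) : Rˣ := α.val g h / α.val h g

variable (α : TwoCocycle R G)

theorem commPairing_self (g : G) : α.commPairing g g = 1 := div_self' _

theorem inv_commPairing (g h : G) : (α.commPairing g h)⁻¹ = α.commPairing h g := inv_div _ _

theorem commPairing_one_right (g : G) : α.commPairing g 1 = 1 := by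
  rw [commPairing, val_one_left, val_one_right, div_self']

end TwoCocycle

namespace TwistedGroupAlgebra

variable {R G : Type} [CommRing R] [Group G] (α : TwoCocycle R G)

/-- The embedding of the units of the coefficient ring in the units of `R^α G`. -/
def scalar : Rˣ →* (TwistedGroupAlgebra α)ˣ :=
  Units.map (algebraMap R (TwistedGroupAlgebra α)).toMonoidHom

theorem val_scalar (c : Rˣ) :
    (scalar α c : TwistedGroupAlgebra α) = algebraMap R _ (c : R) := rfl

theorem scalar_injective : Function.Injective (scalar α) := fun c d h => by
  have h1 : (c : R) • (1 : TwistedGroupAlgebra α) = (d : R) • 1 := by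
    simpa only [val_scalar, Algebra.algebraMap_eq_smul_one] using congrArg Units.val h
  simpa [one_def, Units.ext_iff] using congrArg (fun x => (basis α).repr x 1) h1

theorem scalar_mul_comm (c : Rˣ) (x : (TwistedGroupAlgebra α)ˣ) :
    scalar α c * x = x * scalar α c :=
  Units.ext (Algebra.commutes _ _)

theorem basis_mul_basis_inv (g : G) :
    basis α g * ((α.val g g⁻¹ * α.val 1 1)⁻¹ • basis α g⁻¹) = 1 := by
  rw [mul_smul_comm, basis_mul_basis, mul_inv_cancel, one_def, Units.smul_def, smul_smul,
    ← Units.val_mul, mul_inv_rev, inv_mul_cancel_right]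

theorem basis_inv_mul_basis (g : G) :
    ((α.val g g⁻¹ * α.val 1 1)⁻¹ • basis α g⁻¹) * basis α g = 1 := by
  have val_inv : α.val g⁻¹ g = α.val g g⁻¹ := by
    have h := α.val_mul_val g g⁻¹ g
    rwa [mul_inv_cancel, inv_mul_cancel, α.val_one_left g, α.val_one_right g, mul_comm,
      mul_left_inj, eq_comm] at h
  rw [smul_mul_assoc, basis_mul_basis, inv_mul_cancel, one_def, Units.smul_def, smul_smul,
    ← Units.val_mul, mul_inv_rev, val_inv, inv_mul_cancel_right]

/-- The basis element `u_g` as a unit of `R^α G`. -/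
def unit (g : G) : (TwistedGroupAlgebra α)ˣ where
  val := basis α g
  inv := (α.val g g⁻¹ * α.val 1 1)⁻¹ • basis α g⁻¹
  val_inv := basis_mul_basis_inv α g
  inv_val := basis_inv_mul_basis α g

theorem unit_mul_unit (g h : G) : unit α g * unit α h = scalar α (α.val g h) * unit α (g * h) :=
  Units.ext <| (basis_mul_basis α g h).trans (Algebra.smul_def _ _)

theorem unit_one : unit α 1 = scalar α (α.val 1 1) := by
  rw [← mul_left_inj (unit α 1), unit_mul_unit, mul_one]

/-- A unit of `R^α G` has degree `g` if it is a scalar multiple of `u_g`. -/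
def HasDegree (x : (TwistedGroupAlgebra α)ˣ) (g : G) : Prop := ∃ c : Rˣ, scalar α c * unit α g = x

theorem hasDegree_unit (g : G) : HasDegree α (unit α g) g := ⟨1, by rw [map_one, one_mul]⟩

variable {α} {x y : (TwistedGroupAlgebra α)ˣ} {g h : G}

theorem hasDegree_one_iff : HasDegree α x 1 ↔ ∃ c, scalar α c = x :=
  ⟨fun ⟨c, hc⟩ => ⟨c * α.val 1 1, by rw [map_mul, ← unit_one, hc]⟩,
    fun ⟨c, hc⟩ => ⟨c * (α.val 1 1)⁻¹, by rw [unit_one, ← map_mul, inv_mul_cancel_right, hc]⟩⟩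

theorem scalar_mul_unit_mul (c d : Rˣ) (g h : G) :
    scalar α c * unit α g * (scalar α d * unit α h) =
      scalar α (c * d * α.val g h) * unit α (g * h) := by
  rw [map_mul, map_mul, mul_assoc _ _ (unit α (g * h)), ← unit_mul_unit, mul_assoc, mul_assoc,
    ← mul_assoc (unit α g), ← scalar_mul_comm, mul_assoc]

theorem HasDegree.mul (hx : HasDegree α x g) (hy : HasDegree α y h) :
    HasDegree α (x * y) (g * h) := by
  obtain ⟨c, rfl⟩ := hx
  obtain ⟨d, rfl⟩ := hy
  exact ⟨_, (scalar_mul_unit_mul c d g h).symm⟩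

theorem HasDegree.inv (hx : HasDegree α x g) : HasDegree α x⁻¹ g⁻¹ := by
  obtain ⟨c, hc⟩ := hasDegree_one_iff.mp (mul_inv_cancel g ▸ hx.mul (hasDegree_unit α g⁻¹))
  refine ⟨c⁻¹, eq_inv_of_mul_eq_one_right ?_⟩
  rw [scalar_mul_comm, ← mul_assoc, ← hc, ← map_mul, mul_inv_cancel, map_one]

theorem HasDegree.commutatorElement (hx : HasDegree α x g) (hy : HasDegree α y h) :
    HasDegree α ⁅x, y⁆ ⁅g, h⁆ :=
  ((hx.mul hy).mul hx.inv).mul hy.inv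

theorem HasDegree.commutatorElement_eq (hx : HasDegree α x g) (hy : HasDegree α y h)
    (hgh : Commute g h) : ⁅x, y⁆ = scalar α (α.commPairing g h) := by
  obtain ⟨c, rfl⟩ := hx
  obtain ⟨d, rfl⟩ := hy
  rw [commutatorElement_def, mul_inv_eq_iff_eq_mul, mul_inv_eq_iff_eq_mul,
    mul_assoc (scalar α (α.commPairing g h)), scalar_mul_unit_mul, scalar_mul_unit_mul, hgh.eq,
    ← mul_assoc, ← map_mul,
    TwoCocycle.commPairing, mul_comm d c, mul_left_comm, div_mul_cancel]

end TwistedGroupAlgebra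

namespace TwoCocycle

open TwistedGroupAlgebra

variable {R G : Type} [CommRing R] [Group G] {α : TwoCocycle R G} {g h z : G}

theorem commPairing_mul_left (hg : Commute g z) (hh : Commute h z) :
    α.commPairing (g * h) z = α.commPairing g z * α.commPairing h z := by
  apply scalar_injective α
  have hu := hasDegree_unit α
  rw [← ((hu g).mul (hu h)).commutatorElement_eq (hu z) (hg.mul_left hh),
    commutatorElement_mul_left_eq_conj_mul, (hu h).commutatorElement_eq (hu z) hh,
    (hu g).commutatorElement_eq (hu z) hg, ← scalar_mul_comm α _ (unit α g), mul_inv_cancel_right,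
    ← map_mul, mul_comm]

theorem commPairing_one_left : α.commPairing 1 z = 1 := by
  rw [← inv_commPairing, commPairing_one_right, inv_one]

variable (α) in
/-- The pairing with a fixed element, as a character of its centralizer. -/
def commPairingHom (z : G) : centralizer {z} →* Rˣ where
  toFun g := α.commPairing g z
  map_one' := commPairing_one_left
  map_mul' g h := commPairing_mul_left (mem_centralizer_singleton_iff.mp g.2)
    (mem_centralizer_singleton_iff.mp h.2)

theorem commPairing_zpow_left (h : Commute g z) (i : ℤ) :
    α.commPairing (g ^ i) z = α.commPairing g z ^ i :=
  map_zpow (α.commPairingHom z) ⟨g, mem_centralizer_singleton_iff.mpr h⟩ i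

theorem commPairing_zpow_right (h : Commute g z) (i : ℤ) :
    α.commPairing g (z ^ i) = α.commPairing g z ^ i := by
  rw [← inv_commPairing, commPairing_zpow_left h.symm, ← inv_zpow, inv_commPairing]

theorem commPairing_inv_right (h : Commute g z) : α.commPairing g z⁻¹ = (α.commPairing g z)⁻¹ := by
  simpa only [zpow_neg_one] using commPairing_zpow_right h (-1)

theorem commPairing_pow_right (h : Commute g z) (k : ℕ) :
    α.commPairing g (z ^ k) = α.commPairing g z ^ k := by
  simpa only [zpow_natCast] using commPairing_zpow_right h (k : ℤ)

theorem commPairing_eq_one_of_mem_zpowers {u : G} (h : Commute g z)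
    (h1 : α.commPairing g z = 1) (hu : u ∈ zpowers z) : α.commPairing g u = 1 := by
  obtain ⟨i, rfl⟩ := mem_zpowers_iff.mp hu
  rw [commPairing_zpow_right h, h1, one_zpow]

theorem commPairing_self_pow (g : G) (k : ℕ) : α.commPairing g (g ^ k) = 1 := by
  rw [commPairing_pow_right (Commute.refl g), commPairing_self, one_pow]

variable (α) in
/-- The pairing with a central element, as a character of the group. -/
def centralPairing {z : G} (hz : z ∈ center G) : G →* Rˣ where
  toFun g := α.commPairing g z
  map_one' := commPairing_one_left
  map_mul' g h := commPairing_mul_left (mem_center_iff.mp hz g) (mem_center_iff.mp hz h)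

@[simp] theorem centralPairing_apply {z : G} (hz : z ∈ center G) (g : G) :
    α.centralPairing hz g = α.commPairing g z := rfl

theorem commPairing_conj_left (hz : z ∈ center G) (g x : G) :
    α.commPairing (x * g * x⁻¹) z = α.commPairing g z := by
  simp only [← centralPairing_apply hz, map_mul, map_inv, mul_inv_cancel_comm]

theorem commPairing_commutatorElement_left (hz : z ∈ center G) (x y : G) :
    α.commPairing ⁅x, y⁆ z = 1 := by
  rw [← centralPairing_apply hz, map_commutatorElement, commutatorElement_eq_one_iff_mul_comm,
    mul_comm]

theorem commutatorElement_conj_eq_scalar {x y w : (TwistedGroupAlgebra α)ˣ}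
    (hx : HasDegree α x g) (hy : HasDegree α y h) (hw : HasDegree α w z) (hc : ⁅g, h⁆ ∈ center G) :
    ⁅⁅x, y⁆, y * w * y⁻¹⁆ = scalar α (α.commPairing z ⁅g, h⁆)⁻¹ := by
  rw [(hx.commutatorElement hy).commutatorElement_eq ((hy.mul hw).mul hy.inv)
    (mem_center_iff.mp hc _).symm, ← inv_commPairing, commPairing_conj_left hc]

/-- The Hall–Witt identity for `u_x`, `u_y`, `u_w`, each factor of which is a scalar. -/
theorem commPairing_jacobi {x y w : G} (hxy : ⁅x, y⁆ ∈ center G) (hyw : ⁅y, w⁆ ∈ center G)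
    (hwx : ⁅w, x⁆ ∈ center G) : α.commPairing w ⁅x, y⁆ * α.commPairing x ⁅y, w⁆ *
      α.commPairing y ⁅w, x⁆ = 1 := by
  have hu := hasDegree_unit α
  have hw := commutatorElement_commutatorElement_conj_mul (unit α x) (unit α y) (unit α w)
  rw [commutatorElement_conj_eq_scalar (hu x) (hu y) (hu w) hxy,
    commutatorElement_conj_eq_scalar (hu y) (hu w) (hu x) hyw,
    commutatorElement_conj_eq_scalar (hu w) (hu x) (hu y) hwx, ← map_mul, ← map_mul,
    ← map_one (scalar α)] at hw
  simpa only [← mul_inv, inv_eq_one] using scalar_injective α hw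

/-- The Hall–Witt identity for `u_x`, `u_y` and `⁅u_x, u_y⁆`. -/
theorem commPairing_commutatorElement_swap {x y : G} (hx : ⁅⁅x, y⁆, x⁆ ∈ center G)
    (hy : ⁅⁅x, y⁆, y⁆ ∈ center G) :
    α.commPairing x ⁅⁅x, y⁆, y⁆ = α.commPairing y ⁅⁅x, y⁆, x⁆ := by
  have hu := hasDegree_unit α
  have hc := (hu x).commutatorElement (hu y)
  have hy' : ⁅y, ⁅x, y⁆⁆ ∈ center G := by rwa [← commutatorElement_inv, inv_mem_iff]
  have hw := commutatorElement_commutatorElement_conj_mul (unit α x) (unit α y)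
    ⁅unit α x, unit α y⁆
  have conj_eq : y * ⁅x, y⁆ * y⁻¹ = ⁅y, ⁅x, y⁆⁆ * ⁅x, y⁆ := by
    simp [commutatorElement_def, mul_assoc]
  have hcc : Commute ⁅x, y⁆ ⁅y, ⁅x, y⁆⁆ := mem_center_iff.mp hy' _
  have hfirst : α.commPairing ⁅x, y⁆ (y * ⁅x, y⁆ * y⁻¹) = 1 := by
    rw [conj_eq, ← inv_commPairing, commPairing_mul_left hcc.symm (Commute.refl _),
      commPairing_self, mul_one, inv_commPairing, commPairing_commutatorElement_left hy']
  rw [hc.commutatorElement_eq (((hu y).mul hc).mul (hu y).inv)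
      (conj_eq ▸ hcc.mul_right (Commute.refl _)), hfirst, map_one, one_mul,
    commutatorElement_conj_eq_scalar (hu y) hc (hu x) hy',
    commutatorElement_conj_eq_scalar hc (hu x) (hu y) hx, ← map_mul, ← map_one (scalar α)] at hw
  have h1 := scalar_injective α hw
  rwa [← commutatorElement_inv, commPairing_inv_right (mem_center_iff.mp hy x), inv_inv,
    mul_inv_eq_one] at h1

end TwoCocycle

section Characters

variable (K G : Type) [Field K] [IsAlgClosed K] [CharZero K] [Group G] [Finite G]

theorem card_characters : Nat.card (G →* Kˣ) = (commutator G).index :=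
  (Nat.card_congr Abelianization.lift).trans
    (CommGroup.card_monoidHom_of_hasEnoughRootsOfUnity (Abelianization G) K)

theorem finite_characters : Finite (G →* Kˣ) :=
  Nat.finite_of_card_ne_zero (card_characters K G ▸ index_ne_zero_of_finite)

variable {G}

theorem mem_commutator_of_forall_character {x : G} (h : ∀ χ : G →* Kˣ, χ x = 1) :
    x ∈ commutator G := by
  refine (QuotientGroup.eq_one_iff x).mp ?_
  exact (CommGroup.forall_apply_eq_apply_iff (M := K) (Abelianization G)).mp fun φ =>
    (h (φ.comp Abelianization.of)).trans (map_one φ).symm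

theorem card_characters_le_index {A : Type} [CommGroup A] [Finite A] {B : Subgroup A}
    {S : Subgroup (A →* Kˣ)} (hS : ∀ χ ∈ S, ∀ b ∈ B, χ b = 1) : Nat.card S ≤ B.index := by
  have := finite_characters K A
  rw [Subgroup.index, ← CommGroup.card_domRestrictHom_ker K B]
  refine Subgroup.card_le_of_le fun χ hχ => ?_
  ext b
  exact congrArg Units.val (hS χ hχ b b.2)

end Characters

theorem exists_units_pow_eq {K : Type} [Field K] [IsAlgClosed K] (c : Kˣ) {n : ℕ} (hn : n ≠ 0) :
    ∃ d : Kˣ, d ^ n = c := by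
  obtain ⟨d, hd⟩ := IsAlgClosed.exists_pow_nat_eq (c : K) (Nat.pos_of_ne_zero hn)
  exact ⟨Units.mk0 d fun h => c.ne_zero (by rw [← hd, h, zero_pow hn]), Units.ext hd⟩

namespace TwoCocycle

variable {R G : Type} [CommRing R] [Group G]

theorem val_pow_card [Fintype G] (α : TwoCocycle R G) (g h : G) :
    α.val g h ^ Fintype.card G =
      (∏ j, α.val g j) * (∏ j, α.val h j) / ∏ j, α.val (g * h) j := by
  have key : (∏ j, α.val (g * h) j) * α.val g h ^ Fintype.card G =
      (∏ j, α.val h j) * ∏ j, α.val g j := by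
    rw [← Fintype.prod_equiv (Equiv.mulLeft h) (fun j => α.val g (h * j)) _ fun _ => rfl,
      Fintype.card, ← Finset.prod_const, ← Finset.prod_mul_distrib, ← Finset.prod_mul_distrib]
    exact Finset.prod_congr rfl fun j _ => α.val_mul_val g h j
  rw [eq_div_iff_mul_eq', mul_comm, key, mul_comm]

variable {K : Type} [Field K] [IsAlgClosed K]

theorem exists_cohomologyClass_eq_val_pow_card_eq_one [Fintype G] (α : TwoCocycle K G) :
    ∃ β : TwoCocycle K G, β.cohomologyClass = α.cohomologyClass ∧
      ∀ g h, β.val g h ^ Fintype.card G = 1 := by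
  choose l hl using fun g =>
    exists_units_pow_eq (∏ j, α.val g j) (Fintype.card_ne_zero (α := G))
  refine ⟨α - coboundary l, ?_, fun g h => ?_⟩
  · exact (cohomologyClass_eq_iff.mpr ⟨l, (sub_sub_cancel α _).symm⟩).symm
  · rw [val_sub, val_coboundary, div_pow, div_pow, mul_pow, hl, hl, hl, val_pow_card, div_self']

end TwoCocycle

namespace SecondCohomology

open TwoCocycle

instance finite (K G : Type) [Field K] [IsAlgClosed K] [Group G] [Finite G] :
    Finite (SecondCohomology K G) := by
  have := Fintype.ofFinite G
  let T := {β : TwoCocycle K G // ∀ g h, β.val g h ^ Fintype.card G = 1}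
  have hT : Finite T := by
    refine Finite.of_injective
      (fun (β : T) g h => (⟨β.1.val g h, β.2 g h⟩ : rootsOfUnity (Fintype.card G) K))
      fun β γ h => Subtype.ext (ext_val fun g k => ?_)
    exact congrArg Subtype.val (congrFun (congrFun h g) k)
  refine Finite.of_surjective (fun β : T => β.1.cohomologyClass) fun q => ?_
  obtain ⟨α, rfl⟩ := cohomologyClass_surjective q
  obtain ⟨β, hβα, hβ⟩ := α.exists_cohomologyClass_eq_val_pow_card_eq_one
  exact ⟨⟨β, hβ⟩, hβα⟩

variable {R G : Type} [CommRing R] [Group G]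

variable (R) in
/-- The pairing of `H²(G, Rˣ)` with a central element `z`, sending `[α]` to the character
`g ↦ ⁅u_g, u_z⁆` of `G`; it is adjoint to the Ganea map. -/
def pairing {z : G} (hz : z ∈ center G) : Multiplicative (SecondCohomology R G) →* (G →* Rˣ) :=
  AddMonoidHom.toMultiplicativeLeft <| lift (M := Additive (G →* Rˣ))
    { toFun := fun α => Additive.ofMul (α.centralPairing hz)
      map_zero' := MonoidHom.ext fun _ => div_self' 1
      map_add' := fun α β => MonoidHom.ext fun _ => mul_div_mul_comm _ _ _ _ }
    fun l => MonoidHom.ext fun g => by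
      change l g * l z / l (g * z) / (l z * l g / l (z * g)) = 1
      rw [mem_center_iff.mp hz g, mul_comm (l g), div_self']

theorem pairing_cohomologyClass {z : G} (hz : z ∈ center G) (α : TwoCocycle R G) :
    pairing R hz (Multiplicative.ofAdd α.cohomologyClass) = α.centralPairing hz :=
  congrArg Additive.toMul (lift_cohomologyClass _ _ α)

theorem exists_eq_commPairing_of_mem_range_pairing {z : G} {hz : z ∈ center G} {χ : G →* Rˣ}
    (hχ : χ ∈ (pairing R hz).range) : ∃ α : TwoCocycle R G, ∀ g, χ g = α.commPairing g z := by
  obtain ⟨q, rfl⟩ := hχ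
  obtain ⟨α, hα⟩ := cohomologyClass_surjective q.toAdd
  exact ⟨α, fun g => DFunLike.congr_fun
    ((congrArg (pairing R hz) (congrArg Multiplicative.ofAdd hα.symm)).trans
      (pairing_cohomologyClass hz α)) g⟩

end SecondCohomology

/-- The factor `n ∈ N` in the decomposition of `g` as a coset representative times `n`. -/
def cosetRemainder {G : Type} [Group G] (N : Subgroup G) (g : G) : N :=
  ⟨(g : G ⧸ N).out⁻¹ * g, QuotientGroup.eq.mp (QuotientGroup.out_eq' _)⟩

section CosetRemainder

variable {G : Type} [Group G] {N : Subgroup G}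

theorem out_mul_cosetRemainder (g : G) : (g : G ⧸ N).out * cosetRemainder N g = g :=
  mul_inv_cancel_left _ _

theorem cosetRemainder_mul (g : G) (n : N) : cosetRemainder N (g * n) = cosetRemainder N g * n := by
  have h : (((g * n : G) : G ⧸ N)).out⁻¹ * (g * n) = (g : G ⧸ N).out⁻¹ * g * n := by
    rw [QuotientGroup.mk_mul_of_mem g n.2, mul_assoc]
  exact Subtype.ext h

end CosetRemainder

namespace TwistedGroupAlgebra

variable {R K G : Type} [CommRing R] [Field K] [IsAlgClosed K] [Group G]

theorem HasDegree.pow {α : TwoCocycle R G} {x : (TwistedGroupAlgebra α)ˣ} {g : G}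
    (hx : HasDegree α x g) : ∀ n : ℕ, HasDegree α (x ^ n) (g ^ n)
  | 0 => by simpa only [pow_zero] using hasDegree_one_iff.mpr ⟨1, map_one _⟩
  | n + 1 => by simpa only [pow_succ] using (hx.pow n).mul hx

variable (α : TwoCocycle K G)

theorem exists_hasDegree_pow_orderOf_eq_one {z : G} (hz : orderOf z ≠ 0) :
    ∃ x, HasDegree α x z ∧ x ^ orderOf z = 1 := by
  obtain ⟨c, hc⟩ := hasDegree_one_iff.mp (pow_orderOf_eq_one z ▸ (hasDegree_unit α z).pow _)
  obtain ⟨d, hd⟩ := exists_units_pow_eq c hz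
  refine ⟨scalar α d⁻¹ * unit α z, ⟨d⁻¹, rfl⟩, ?_⟩
  rw [Commute.mul_pow (scalar_mul_comm α _ _), ← hc, ← map_pow, ← map_mul, inv_pow, hd,
    inv_mul_cancel, map_one]

theorem exists_hom_zpowers_hasDegree [Finite G] (z : G) :
    ∃ σ : zpowers z →* (TwistedGroupAlgebra α)ˣ, ∀ n, HasDegree α (σ n) n := by
  obtain ⟨x, hxz, hx⟩ := exists_hasDegree_pow_orderOf_eq_one α (orderOf_pos z).ne'
  let z' : zpowers z := ⟨z, mem_zpowers z⟩
  have hgen (n : zpowers z) : ∃ i : ℕ, n = z' ^ i := by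
    obtain ⟨i, hi⟩ := mem_powers_iff_mem_zpowers.mpr n.2
    exact ⟨i, Subtype.ext hi.symm⟩
  have hord : orderOf x ∣ orderOf z' :=
    (orderOf_dvd_of_pow_eq_one hx).trans (orderOf_mk z _).symm.dvd
  let σ := monoidHomOfForallMemZpowers
    (fun n => (hgen n).elim fun i hi => hi ▸ npow_mem_zpowers z' i) hord
  refine ⟨σ, fun n => ?_⟩
  obtain ⟨i, rfl⟩ := hgen n
  rw [map_pow, show σ z' = x from monoidHomOfForallMemZpowers_apply_gen _ hord]
  exact hxz.pow i

theorem exists_coboundary_add_periodic {α : TwoCocycle R G} {N : Subgroup G} (hN : N ≤ center G)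
    (σ : N →* (TwistedGroupAlgebra α)ˣ) (hσ : ∀ n, HasDegree α (σ n) n)
    (hα : ∀ g, ∀ n ∈ N, α.commPairing g n = 1) :
    ∃ l : G → Rˣ, ∀ g h, ∀ m ∈ N, ∀ n ∈ N,
      (α + TwoCocycle.coboundary l).val (g * m) (h * n) =
        (α + TwoCocycle.coboundary l).val g h := by
  let s (g : G) := unit α (g : G ⧸ N).out * σ (cosetRemainder N g)
  have hs (g : G) : HasDegree α (s g) g := by
    simpa only [out_mul_cosetRemainder] using
      (hasDegree_unit α (g : G ⧸ N).out).mul (hσ (cosetRemainder N g))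
  choose l hl using hs
  set γ := α + TwoCocycle.coboundary l with hγ
  have s_mul (g : G) (n : N) : s (g * n) = s g * σ n := by
    simp only [s, cosetRemainder_mul, map_mul, mul_assoc, QuotientGroup.mk_mul_of_mem g n.2]
  have s_comm (g : G) (n : N) : Commute (s g) (σ n) := by
    rw [← commutatorElement_eq_one_iff_commute, HasDegree.commutatorElement_eq ⟨l g, hl g⟩ (hσ n)
      (mem_center_iff.mp (hN n.2) g), hα g n n.2, map_one]
  have s_mul_s (g h : G) : s g * s h = scalar α (γ.val g h) * s (g * h) := by
    rw [← hl, ← hl, ← hl, scalar_mul_unit_mul, ← mul_assoc, ← map_mul, hγ, TwoCocycle.val_add,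
      TwoCocycle.val_coboundary, mul_assoc (α.val g h), div_mul_cancel, mul_comm (α.val g h)]
  refine ⟨l, fun g h m hm n hn => scalar_injective α ?_⟩
  lift m to N using hm
  lift n to N using hn
  have hmul : g * m * (h * n) = g * h * (m * n : N) :=
    Commute.mul_mul_mul_comm (mem_center_iff.mp (hN m.2) h).symm g n
  rw [← mul_left_inj (s (g * m * (h * n))), ← s_mul_s, s_mul, s_mul, hmul, s_mul,
    ← mul_assoc (scalar α _), ← s_mul_s, map_mul, mul_assoc, ← mul_assoc (σ m),
    ← (s_comm h m).eq]
  simp only [mul_assoc]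

end TwistedGroupAlgebra

namespace SecondCohomology

open TwoCocycle

variable {K G : Type} [Field K] [Group G]

theorem cohomologyClass_mem_range_comap_mk' [IsAlgClosed K] [Finite G] {z : G}
    (hz : z ∈ center G) [(zpowers z).Normal] {α : TwoCocycle K G}
    (hα : ∀ g, α.commPairing g z = 1) :
    α.cohomologyClass ∈ (comap (R := K) (QuotientGroup.mk' (zpowers z))).range := by
  obtain ⟨σ, hσ⟩ := TwistedGroupAlgebra.exists_hom_zpowers_hasDegree α z
  obtain ⟨l, hl⟩ := TwistedGroupAlgebra.exists_coboundary_add_periodic (zpowers_le.mpr hz) σ hσ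
    fun g n hn => commPairing_eq_one_of_mem_zpowers (mem_center_iff.mp hz g) (hα g) hn
  obtain ⟨β, hβ⟩ := exists_comap_mk'_eq _ hl
  refine ⟨β.cohomologyClass, ?_⟩
  rw [comap_cohomologyClass, hβ, cohomologyClass_eq_iff]
  exact ⟨l, (add_sub_cancel_left α _).symm⟩

theorem card_le_card_quotient_mul_card_range_pairing [IsAlgClosed K] [Finite G] {z : G}
    (hz : z ∈ center G) [(zpowers z).Normal] :
    Nat.card (SecondCohomology K G) ≤
      Nat.card (comap (R := K) (QuotientGroup.mk' (zpowers z))).range *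
        Nat.card (pairing K hz).range := by
  have hker : (pairing K hz).ker ≤
      (comap (R := K) (QuotientGroup.mk' (zpowers z))).range.toSubgroup := fun q hq => by
    obtain ⟨α, rfl⟩ := Multiplicative.ofAdd.surjective.comp cohomologyClass_surjective q
    refine cohomologyClass_mem_range_comap_mk' hz fun g => ?_
    rw [← centralPairing_apply hz, ← pairing_cohomologyClass]
    exact DFunLike.congr_fun hq g
  calc Nat.card (SecondCohomology K G)
      = Nat.card (pairing K hz).ker * Nat.card (pairing K hz).range :=
        (card_mul_index (pairing K hz).ker).symm.trans (congrArg _ (index_ker _))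
    _ ≤ _ := Nat.mul_le_mul_right _ (card_le_of_le hker)

section Transgression

variable {N : Subgroup G} {R : Type} [CommRing R]

theorem exists_comap_mk'_eq_coboundary [N.Normal] (hN : N ≤ center G) (χ : N →* Rˣ) :
    ∃ β : TwoCocycle R (G ⧸ N), TwoCocycle.comap (QuotientGroup.mk' N) β =
      coboundary (χ ∘ cosetRemainder N) := by
  refine exists_comap_mk'_eq _ fun g h m hm n hn => ?_
  lift m to N using hm
  lift n to N using hn
  have hmul : g * m * (h * n) = g * h * (m * n : N) :=
    Commute.mul_mul_mul_comm (mem_center_iff.mp (hN m.2) h).symm g n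
  simp only [val_coboundary, Function.comp_apply, hmul, cosetRemainder_mul, map_mul]
  rw [mul_mul_mul_comm, mul_div_mul_right_eq_div]

theorem eq_of_coboundary_eq [N.Normal] (hN : N ≤ commutator G) {χ μ : N →* Rˣ}
    {l : G ⧸ N → Rˣ} (hl : coboundary (l ∘ QuotientGroup.mk' N) =
      coboundary (χ ∘ cosetRemainder N) - coboundary (μ ∘ cosetRemainder N)) : χ = μ := by
  let f (g : G) : Rˣ := χ (cosetRemainder N g) / μ (cosetRemainder N g) / l g
  have f_mul (g h : G) : f (g * h) = f g * f h := by
    have := congrArg (fun γ => γ.val g h) hl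
    simp only [val_sub, val_coboundary, Function.comp_apply, QuotientGroup.mk'_apply] at this
    rw [eq_comm, ← div_eq_one]
    simp only [f]
    rw [div_mul_div_comm, div_mul_div_comm, div_div_div_comm, div_div_div_comm (_ * _), ← this,
      div_self']
  have f_eq_one {g : G} (hg : g ∈ N) : f g = 1 :=
    Abelianization.commutator_subset_ker (MonoidHom.mk' f f_mul) (hN hg)
  ext n
  have hn := (f_eq_one n.2).trans (f_eq_one (one_mem N)).symm
  have hrem : cosetRemainder N (n : G) = cosetRemainder N 1 * n := by
    rw [← cosetRemainder_mul, one_mul]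
  have hmk : ((n : G) : G ⧸ N) = (1 : G) := (QuotientGroup.eq_one_iff _).mpr n.2
  simp only [f, hrem, hmk, map_mul] at hn
  rw [div_left_inj, mul_div_mul_comm, mul_eq_left, div_eq_one] at hn
  rw [hn]

end Transgression

theorem card_le_card_ker_comap_mk' [IsAlgClosed K] [CharZero K] [Finite G] {N : Subgroup G}
    [N.Normal] (hN : N ≤ center G) (hN' : N ≤ commutator G) :
    Nat.card N ≤ Nat.card (comap (R := K) (QuotientGroup.mk' N)).ker := by
  choose β hβ using exists_comap_mk'_eq_coboundary (R := K) hN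
  have hcard : Nat.card (N →* Kˣ) = Nat.card N := by
    have : IsMulCommutative N := ⟨⟨fun a b => Subtype.ext (mem_center_iff.mp (hN b.2) a)⟩⟩
    rw [card_characters, commutator_eq_bot, index_bot]
  rw [← hcard]
  refine Nat.card_le_card_of_injective (fun χ => ⟨(β χ).cohomologyClass, ?_⟩) fun χ μ h => ?_
  · rw [AddMonoidHom.mem_ker, comap_cohomologyClass, cohomologyClass_eq_zero_iff]
    exact ⟨_, (hβ χ).symm⟩
  · obtain ⟨l, hl⟩ := cohomologyClass_eq_iff.mp (congrArg Subtype.val h)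
    refine eq_of_coboundary_eq hN' (l := l) ?_
    rw [← hβ, ← hβ]
    exact congrArg (TwoCocycle.comap (QuotientGroup.mk' N)) hl

theorem orderOf_mul_card_le [IsAlgClosed K] [CharZero K] [Finite G] {z : G} (hz : z ∈ center G)
    (hz' : z ∈ commutator G) [(zpowers z).Normal] :
    orderOf z * Nat.card (SecondCohomology K G) ≤
      Nat.card (SecondCohomology K (G ⧸ zpowers z)) * Nat.card (pairing K hz).range := by
  have htrans := card_le_card_ker_comap_mk' (K := K) (zpowers_le.mpr hz) (zpowers_le.mpr hz')
  rw [Nat.card_zpowers] at htrans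
  calc orderOf z * Nat.card (SecondCohomology K G)
      ≤ Nat.card (comap (R := K) (QuotientGroup.mk' (zpowers z))).ker *
          (Nat.card (comap (R := K) (QuotientGroup.mk' (zpowers z))).range *
            Nat.card (pairing K hz).range) :=
        Nat.mul_le_mul htrans (card_le_card_quotient_mul_card_range_pairing hz)
    _ = _ := by
      rw [← mul_assoc, ← AddSubgroup.index_ker, AddSubgroup.card_mul_index]

end SecondCohomology

namespace TwistedGroupAlgebra

variable {R G H A : Type} [CommRing R] [Group G] [Group H] [Ring A] [Algebra R A]

/-- The algebra homomorphism `R^α G → A` with prescribed values on the basis `(u_g)`. -/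
def lift (α : TwoCocycle R G) (f : G → A) (h_one : f 1 = algebraMap R A (α.val 1 1))
    (h_mul : ∀ g h, f g * f h = (α.val g h : R) • f (g * h)) : TwistedGroupAlgebra α →ₐ[R] A :=
  AlgHom.ofLinearMap ((basis α).constr R f)
    (by
      rw [one_def, map_smul, Module.Basis.constr_basis, h_one, Algebra.algebraMap_eq_smul_one,
        smul_smul, ← Units.val_mul, inv_mul_cancel, Units.val_one, one_smul])
    ((LinearMap.map_mul_iff _).mpr <| (basis α).ext fun g => (basis α).ext fun h => by
      simp [basis_mul_basis, h_mul])

theorem algHom_ext {α : TwoCocycle R G} {φ ψ : TwistedGroupAlgebra α →ₐ[R] A}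
    (h : ∀ g, φ (basis α g) = ψ (basis α g)) : φ = ψ :=
  AlgHom.toLinearMap_injective ((basis α).ext h)

variable (R G) in
/-- The one-dimensional representations of the untwisted group algebra are the characters of the
group. -/
def algHomEquiv : (TwistedGroupAlgebra (0 : TwoCocycle R G) →ₐ[R] R) ≃ (G →* Rˣ) where
  toFun φ := MonoidHom.toHomUnits
    { toFun := fun g => φ (basis 0 g)
      map_one' := by
        rw [← map_one φ, one_def, TwoCocycle.val_zero, inv_one, Units.val_one, one_smul]
      map_mul' := fun g h => by
        rw [← map_mul, basis_mul_basis, TwoCocycle.val_zero, Units.val_one, one_smul] }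
  invFun χ := lift 0 (fun g => (χ g : R)) (by simp) (by simp)
  left_inv φ := algHom_ext fun g => (basis 0).constr_basis R _ g
  right_inv χ := MonoidHom.ext fun g => Units.ext ((basis 0).constr_basis R _ g)

variable {α : TwoCocycle R G} {β : TwoCocycle R H}

/-- The homomorphism `u_g ↦ l(g) u_{f(g)}` of twisted group algebras. -/
def map (f : G →* H) (l : G → Rˣ)
    (hl : TwoCocycle.coboundary l = α - TwoCocycle.comap f β) :
    TwistedGroupAlgebra α →ₐ[R] TwistedGroupAlgebra β :=
  have val_eq (g h : G) : l g * l h * β.val (f g) (f h) = α.val g h * l (g * h) := by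
    have := congrArg (fun γ => γ.val g h) hl
    simpa only [TwoCocycle.val_coboundary, TwoCocycle.val_sub, TwoCocycle.val_comap,
      div_eq_div_iff_mul_eq_mul] using this
  lift α (fun g => (l g : R) • basis β (f g))
    (by
      have h1 : l 1 = α.val 1 1 * (β.val 1 1)⁻¹ := by
        have := val_eq 1 1
        rw [map_one, mul_one, mul_comm (α.val 1 1), mul_assoc, mul_right_inj] at this
        exact eq_mul_inv_of_mul_eq this
      rw [map_one, h1, Units.val_mul, mul_smul, ← one_def, Algebra.algebraMap_eq_smul_one])
    fun g h => by
      rw [smul_mul_smul_comm, basis_mul_basis, smul_smul, smul_smul, f.map_mul, ← Units.val_mul,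
        ← Units.val_mul, ← Units.val_mul, val_eq]

theorem map_basis (f : G →* H) (l : G → Rˣ) (hl) (g : G) :
    map (α := α) (β := β) f l hl (basis α g) = (l g : R) • basis β (f g) :=
  (basis α).constr_basis R _ g

theorem nonempty_algEquiv (f : G ≃* H)
    (h : α.cohomologyClass = (TwoCocycle.comap f.toMonoidHom β).cohomologyClass) :
    Nonempty (TwistedGroupAlgebra α ≃ₐ[R] TwistedGroupAlgebra β) := by
  obtain ⟨l, hl⟩ := TwoCocycle.cohomologyClass_eq_iff.mp h
  have hl' : TwoCocycle.coboundary (l⁻¹ ∘ f.symm) =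
      β - TwoCocycle.comap f.symm.toMonoidHom α := by
    refine TwoCocycle.ext_val fun g k => ?_
    have := congrArg (fun γ => (γ.val (f.symm g) (f.symm k))⁻¹) hl
    simpa [div_eq_mul_inv, mul_comm] using this
  refine ⟨AlgEquiv.ofAlgHom (map f.toMonoidHom l hl) (map f.symm.toMonoidHom _ hl')
    (algHom_ext fun g => ?_) (algHom_ext fun g => ?_)⟩
  · simp [map_basis, smul_smul]
  · simp [map_basis, smul_smul]

end TwistedGroupAlgebra

namespace TwistIsomorphic

theorem of_mulEquiv (R : Type) [CommRing R] {G H : Type} [Group G] [Group H] (f : G ≃* H) :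
    TwistIsomorphic R G H :=
  ⟨SecondCohomology.congr f, fun α _ h =>
    (TwistedGroupAlgebra.nonempty_algEquiv f.symm <|
      h.symm.trans (SecondCohomology.comap_cohomologyClass _ α)).map AlgEquiv.symm⟩

variable {K G H : Type} [Field K] [Group G] [Group H]

theorem card_secondCohomology_eq (h : TwistIsomorphic K G H) :
    Nat.card (SecondCohomology K G) = Nat.card (SecondCohomology K H) :=
  Nat.card_congr h.choose.toEquiv

theorem index_commutator_eq [IsAlgClosed K] [CharZero K] [Finite G] [Finite H]
    (h : TwistIsomorphic K G H) : (commutator G).index = (commutator H).index := by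
  obtain ⟨ψ, hψ⟩ := h
  have class_zero (L : Type) [Group L] : (0 : TwoCocycle K L).cohomologyClass = 0 :=
    TwoCocycle.cohomologyClassHom.map_zero
  obtain ⟨e⟩ := hψ 0 0 (by rw [class_zero, class_zero, ψ.map_zero])
  rw [← card_characters K, ← card_characters K]
  exact Nat.card_congr <| (TwistedGroupAlgebra.algHomEquiv K G).symm.trans <|
    (e.arrowCongr AlgEquiv.refl).trans (TwistedGroupAlgebra.algHomEquiv K H)

theorem card_commutator_eq [IsAlgClosed K] [CharZero K] [Finite G] [Finite H]
    (h : TwistIsomorphic K G H) (hGH : Nat.card G = Nat.card H) :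
    Nat.card (commutator G) = Nat.card (commutator H) := by
  refine Nat.eq_of_mul_eq_mul_right (Nat.pos_of_ne_zero (commutator G).index_ne_zero_of_finite) ?_
  rw [card_mul_index, hGH, h.index_commutator_eq, card_mul_index]

end TwistIsomorphic

section PrimeOrder

variable {G : Type} [Group G]

theorem normal_of_le_center {N : Subgroup G} (hN : N ≤ center G) : N.Normal :=
  ⟨fun n hn g => by rwa [mem_center_iff.mp (hN hn) g, mul_inv_cancel_right]⟩

theorem commutatorElement_mem_commutator (x y : G) : ⁅x, y⁆ ∈ commutator G :=
  commutator_mem_commutator (mem_top x) (mem_top y)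

theorem card_mul_card_commutator_quotient {N : Subgroup G} [N.Normal] (hN : N ≤ commutator G) :
    Nat.card N * Nat.card (commutator (G ⧸ N)) = Nat.card (commutator G) := by
  have hmap : commutator (G ⧸ N) = (commutator G).map (QuotientGroup.mk' N) := by
    rw [_root_.commutator_def, _root_.commutator_def, map_commutator,
      map_top_of_surjective _ (QuotientGroup.mk'_surjective N)]
  rw [hmap, ← relIndex_ker, QuotientGroup.ker_mk', ← relIndex_bot_left N,
    relIndex_mul_relIndex _ _ _ bot_le hN, relIndex_bot_left]

theorem exists_commutatorElement_ne_one (h : commutator G ≠ ⊥) : ∃ x y : G, ⁅x, y⁆ ≠ 1 := by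
  by_contra! hc
  refine h (eq_bot_iff.mpr ((commutator_le (H₁ := ⊤) (H₂ := ⊤)).mpr fun x _ y _ => ?_))
  exact mem_bot.mpr (hc x y)

variable {p : ℕ} [Fact p.Prime]

theorem mem_zpowers_of_orderOf_eq_prime {z u : G} (ho : orderOf z = p) (hu : u ∈ zpowers z)
    (hu1 : u ≠ 1) : z ∈ zpowers u := by
  have hcard : Nat.card (zpowers z) = p := by rw [Nat.card_zpowers, ho]
  obtain ⟨j, hj⟩ := mem_zpowers_iff.mp <|
    mem_zpowers_of_prime_card (G := zpowers z) hcard (g := ⟨u, hu⟩) (g' := ⟨z, mem_zpowers z⟩)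
      fun h => hu1 (congrArg Subtype.val h)
  exact mem_zpowers_iff.mpr ⟨j, congrArg Subtype.val hj⟩

theorem card_quotient_zpowers_of_orderOf_eq_prime {n : ℕ} (hG : Nat.card G = p ^ (n + 1)) {z : G}
    (ho : orderOf z = p) : Nat.card (G ⧸ zpowers z) = p ^ n := by
  have h := card_mul_index (zpowers z)
  rw [Nat.card_zpowers, ho, hG, pow_succ', index] at h
  exact Nat.eq_of_mul_eq_mul_left (Fact.out : p.Prime).pos h

theorem card_commutator_quotient_zpowers {k : ℕ} (hk : Nat.card (commutator G) = p ^ (k + 1))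
    {z : G} [(zpowers z).Normal] (ho : orderOf z = p) (hz : z ∈ commutator G) :
    Nat.card (commutator (G ⧸ zpowers z)) = p ^ k := by
  have h := card_mul_card_commutator_quotient (zpowers_le.mpr hz)
  rw [Nat.card_zpowers, ho, hk, pow_succ'] at h
  exact Nat.eq_of_mul_eq_mul_left (Fact.out : p.Prime).pos h

theorem ne_bot_of_card_eq_prime_pow_succ {N : Subgroup G} {k : ℕ}
    (hN : Nat.card N = p ^ (k + 1)) : N ≠ ⊥ := fun h =>
  (Nat.one_lt_pow k.succ_ne_zero (Fact.out : p.Prime).one_lt).ne (hN ▸ (card_eq_one.mpr h).symm)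

theorem exists_mem_center_orderOf_eq_prime [Finite G] (hG : IsPGroup p G) {N : Subgroup G}
    [N.Normal] (hN : N ≠ ⊥) : ∃ z ∈ N, z ∈ center G ∧ orderOf z = p := by
  have hpN : p ∣ Nat.card N :=
    (hG.to_subgroup N).card_eq_or_dvd.resolve_left (mt card_eq_one.mp hN)
  have hconj : IsPGroup p (ConjAct G) := hG
  obtain ⟨⟨b, hbN⟩, hb, hb1⟩ := hconj.exists_fixed_point_of_prime_dvd_card_of_fixed_point N hpN
    (a := 1) fun g => smul_one g
  have hbc : b ∈ center G := mem_center_iff.mpr fun g => by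
    have h := congrArg Subtype.val (hb (ConjAct.toConjAct g))
    rw [ConjAct.Subgroup.val_conj_smul, ConjAct.toConjAct_smul] at h
    exact mul_inv_eq_iff_eq_mul.mp h
  have hd : p ∣ orderOf b := hG.dvd_orderOf fun h => hb1 (Subtype.ext h.symm)
  exact ⟨b ^ (orderOf b / p), pow_mem hbN _, pow_mem hbc _,
    orderOf_pow_orderOf_div (orderOf_pos _).ne' hd⟩

theorem exists_eq_zpowers_of_card_eq_prime [Finite G] (hG : IsPGroup p G) {N : Subgroup G}
    [N.Normal] (hN : Nat.card N = p) : ∃ z ∈ center G, orderOf z = p ∧ N = zpowers z := by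
  obtain ⟨z, hzN, hz, ho⟩ := exists_mem_center_orderOf_eq_prime hG
    (ne_bot_of_card_eq_prime_pow_succ (hN.trans (pow_one p).symm))
  refine ⟨z, hz, ho, (eq_of_le_of_card_ge (zpowers_le.mpr hzN) ?_).symm⟩
  rw [hN, Nat.card_zpowers, ho]

theorem index_le_pow_pred_of_lt {n m : ℕ} (hG : Nat.card G = p ^ n) {N M : Subgroup G}
    (hNM : N < M) (hN : N.index = p ^ m) : M.index ≤ p ^ (m - 1) := by
  have hp : p.Prime := Fact.out
  have : Finite G := Nat.finite_of_card_ne_zero (hG ▸ pow_ne_zero _ hp.ne_zero)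
  have hlt : M.index < N.index := index_strictAnti hNM
  obtain ⟨j, -, hj⟩ := (Nat.dvd_prime_pow hp).mp (hG ▸ M.index_dvd_card)
  rw [hj, hN, Nat.pow_lt_pow_iff_right hp.one_lt] at hlt
  exact hj.trans_le (Nat.pow_le_pow_right hp.pos (Nat.le_pred_of_lt hlt))

end PrimeOrder

namespace SecondCohomology

section Pairing

variable {R G : Type} [CommRing R] [Group G] {z : G} {hz : z ∈ center G} {χ : G →* Rˣ}

theorem pow_orderOf_eq_one_of_mem_range_pairing (hχ : χ ∈ (pairing R hz).range) (g : G) :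
    χ g ^ orderOf z = 1 := by
  obtain ⟨α, hα⟩ := exists_eq_commPairing_of_mem_range_pairing hχ
  rw [hα, ← α.commPairing_pow_right (mem_center_iff.mp hz g), pow_orderOf_eq_one,
    α.commPairing_one_right]

theorem zpowers_le_ker_of_mem_range_pairing (hχ : χ ∈ (pairing R hz).range) :
    zpowers z ≤ χ.ker := by
  obtain ⟨α, hα⟩ := exists_eq_commPairing_of_mem_range_pairing hχ
  exact zpowers_le.mpr ((hα z).trans (α.commPairing_self z))

end Pairing

instance subsingleton (R G : Type) [CommRing R] [Group G] [Subsingleton G] :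
    Subsingleton (SecondCohomology R G) := by
  refine subsingleton_of_forall_eq 0 fun q => ?_
  obtain ⟨α, rfl⟩ := TwoCocycle.cohomologyClass_surjective q
  refine TwoCocycle.cohomologyClass_eq_zero_iff.mpr ⟨fun _ => α.val 1 1, TwoCocycle.ext_val ?_⟩
  intro g h
  rw [TwoCocycle.val_coboundary, mul_div_cancel_right, Subsingleton.elim g 1, Subsingleton.elim h 1]

/- As `z` is a power of `yᵖ`, the pairing of `x` with `z` is a power of that of `xᵖ` with `y`, and
`xᵖ` is a power of `y`. -/
theorem range_pairing_eq_bot_of_pow_mem {R A : Type} [CommRing R] [CommGroup A] {p : ℕ}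
    [Fact p.Prime] {z : A} (hz : z ∈ center A) (ho : orderOf z = p)
    (hpow : ∀ x : A, x ^ p ∈ zpowers z) {y : A} (hy : y ^ p ≠ 1) : (pairing R hz).range = ⊥ := by
  have hzy : z ∈ zpowers (y ^ p) := mem_zpowers_of_orderOf_eq_prime ho (hpow y) hy
  refine eq_bot_iff.mpr fun χ hχ => mem_bot.mpr (MonoidHom.ext fun x => ?_)
  obtain ⟨α, hα⟩ := exists_eq_commPairing_of_mem_range_pairing hχ
  have hyx : α.commPairing y (x ^ p) = 1 :=
    α.commPairing_eq_one_of_mem_zpowers (Commute.all _ _) (α.commPairing_self y) <|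
      zpowers_le.mpr (zpowers_le.mpr (pow_mem (mem_zpowers y) p) hzy) (hpow x)
  have hxy : α.commPairing x (y ^ p) = 1 := by
    rw [α.commPairing_pow_right (Commute.all _ _), ← α.inv_commPairing, inv_pow,
      ← α.commPairing_pow_right (Commute.all _ _), hyx, inv_one]
  rw [hα, MonoidHom.one_apply]
  exact α.commPairing_eq_one_of_mem_zpowers (Commute.all _ _) hxy hzy

section Abelian

variable {K A : Type} [Field K] [IsAlgClosed K] [CommGroup A] {p : ℕ} [Fact p.Prime] {m : ℕ}
  {z : A}

theorem card_le_card_quotient_mul [Finite A] (hz : z ∈ center A) {b : ℕ}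
    (hb : Nat.card (pairing K hz).range ≤ b) :
    Nat.card (SecondCohomology K A) ≤ Nat.card (SecondCohomology K (A ⧸ zpowers z)) * b :=
  (card_le_card_quotient_mul_card_range_pairing hz).trans <| Nat.mul_le_mul
    (Nat.card_le_card_of_surjective _ (AddMonoidHom.rangeRestrict_surjective _)) hb

theorem card_range_pairing_le_index [CharZero K] [Finite A] (hz : z ∈ center A) :
    Nat.card (pairing K hz).range ≤ (zpowers z).index :=
  card_characters_le_index K fun _ hχ _ hg => zpowers_le_ker_of_mem_range_pairing hχ hg

theorem card_range_pairing_le_of_pow_notMem [CharZero K] (hA : Nat.card A = p ^ (m + 1))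
    (hz : z ∈ center A) (ho : orderOf z = p) {v : A} (hv : v ^ p ∉ zpowers z) :
    Nat.card (pairing K hz).range ≤ p ^ (m - 1) := by
  have : Finite A := Nat.finite_of_card_ne_zero (hA ▸ pow_ne_zero _ (Fact.out : p.Prime).ne_zero)
  have hlt : zpowers z < zpowers z ⊔ zpowers (v ^ p) :=
    left_lt_sup.mpr fun h => hv (zpowers_le.mp h)
  refine le_trans (card_characters_le_index K fun χ hχ => ?_)
    (index_le_pow_pred_of_lt hA hlt (card_quotient_zpowers_of_orderOf_eq_prime hA ho))
  have hvχ : v ^ p ∈ χ.ker := by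
    rw [MonoidHom.mem_ker, map_pow, ← ho, pow_orderOf_eq_one_of_mem_range_pairing hχ]
  exact sup_le (zpowers_le_ker_of_mem_range_pairing hχ) (zpowers_le.mpr hvχ)

end Abelian

variable (K : Type) [Field K] [IsAlgClosed K] [CharZero K] {p : ℕ} [Fact p.Prime]

theorem card_le_pow_choose_two {m : ℕ} {A : Type} [CommGroup A] (hA : Nat.card A = p ^ m) :
    Nat.card (SecondCohomology K A) ≤ p ^ m.choose 2 := by
  induction m generalizing A with
  | zero =>
    have : Subsingleton A := (Nat.card_eq_one_iff_unique.mp hA).1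
    rw [Nat.card_of_subsingleton (0 : SecondCohomology K A), Nat.choose_zero_succ, pow_zero]
  | succ m ih =>
    have : Finite A := Nat.finite_of_card_ne_zero (hA ▸ pow_ne_zero _ (Fact.out : p.Prime).ne_zero)
    obtain ⟨z, ho⟩ := exists_prime_orderOf_dvd_card' (G := A) p (hA ▸ dvd_pow_self p m.succ_ne_zero)
    have hz : z ∈ center A := CommGroup.center_eq_top (G := A) ▸ mem_top z
    have hQ : Nat.card (A ⧸ zpowers z) = p ^ m := card_quotient_zpowers_of_orderOf_eq_prime hA ho
    calc Nat.card (SecondCohomology K A)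
        ≤ Nat.card (SecondCohomology K (A ⧸ zpowers z)) * p ^ m :=
          card_le_card_quotient_mul hz ((card_range_pairing_le_index hz).trans_eq hQ)
      _ ≤ p ^ m.choose 2 * p ^ m := Nat.mul_le_mul_right _ (ih hQ)
      _ = p ^ (m + 1).choose 2 := by
        rw [← pow_add, Nat.choose_succ_succ' m 1, Nat.choose_one_right, add_comm]

theorem card_le_pow_choose_two_of_pow_ne_one {m : ℕ} {A : Type} [CommGroup A]
    (hA : Nat.card A = p ^ (m + 1)) {y : A} (hy : y ^ p ≠ 1) :
    Nat.card (SecondCohomology K A) ≤ p ^ m.choose 2 := by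
  induction m generalizing A with
  | zero => exact absurd (pow_card_eq_one' (x := y)) (by rwa [hA, zero_add, pow_one])
  | succ m ih =>
    have : Finite A := Nat.finite_of_card_ne_zero (hA ▸ pow_ne_zero _ (Fact.out : p.Prime).ne_zero)
    obtain ⟨z, ho⟩ := exists_prime_orderOf_dvd_card' (G := A) p
      (hA ▸ dvd_pow_self p (m + 1).succ_ne_zero)
    have hz : z ∈ center A := CommGroup.center_eq_top (G := A) ▸ mem_top z
    have hQ : Nat.card (A ⧸ zpowers z) = p ^ (m + 1) :=
      card_quotient_zpowers_of_orderOf_eq_prime hA ho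
    by_cases hpow : ∀ x : A, x ^ p ∈ zpowers z
    · have htriv : Nat.card (pairing K hz).range ≤ 1 := by
        rw [range_pairing_eq_bot_of_pow_mem hz ho hpow hy, card_bot]
      exact (card_le_card_quotient_mul hz htriv).trans
        ((mul_one _).trans_le (card_le_pow_choose_two K hQ))
    · obtain ⟨v, hv⟩ := not_forall.mp hpow
      have hv' : (v : A ⧸ zpowers z) ^ p ≠ 1 := fun h => hv ((QuotientGroup.eq_one_iff _).mp h)
      calc Nat.card (SecondCohomology K A)
          ≤ Nat.card (SecondCohomology K (A ⧸ zpowers z)) * p ^ m :=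
            card_le_card_quotient_mul hz (card_range_pairing_le_of_pow_notMem hA hz ho hv)
        _ ≤ p ^ m.choose 2 * p ^ m := Nat.mul_le_mul_right _ (ih hQ hv')
        _ = p ^ (m + 1).choose 2 := by
          rw [← pow_add, Nat.choose_succ_succ' m 1, Nat.choose_one_right, add_comm]

end SecondCohomology

theorem card_rootsOfUnity_prime (K : Type) [Field K] [IsAlgClosed K] [CharZero K] (p : ℕ)
    [Fact p.Prime] : Nat.card (rootsOfUnity p K) = p := by
  have : NeZero p := ⟨(Fact.out : p.Prime).ne_zero⟩
  exact HasEnoughRootsOfUnity.natCard_rootsOfUnity K p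

namespace SecondCohomology

section CommutatorPrime

variable {G : Type} [Group G] {p : ℕ} [Fact p.Prime] {z : G} (hz : z ∈ center G)

section Pairing

variable {R : Type} [CommRing R] (ho : orderOf z = p) (hG' : commutator G = zpowers z)
  {x y : G} (hxy : ⁅x, y⁆ ≠ 1)

include ho hG' hxy

theorem eq_one_of_mem_range_pairing {χ : G →* Rˣ} (hχ : χ ∈ (pairing R hz).range) (hx : χ x = 1)
    (hy : χ y = 1) : χ = 1 := by
  obtain ⟨α, hα⟩ := exists_eq_commPairing_of_mem_range_pairing hχ
  have hmem (u v : G) : ⁅u, v⁆ ∈ zpowers z := hG' ▸ commutatorElement_mem_commutator u v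
  have hcen (u v : G) : ⁅u, v⁆ ∈ center G := zpowers_le.mpr hz (hmem u v)
  have hpair {u : G} (hu : χ u = 1) (v w : G) : α.commPairing u ⁅v, w⁆ = 1 :=
    α.commPairing_eq_one_of_mem_zpowers (mem_center_iff.mp hz u) ((hα u).symm.trans hu) (hmem v w)
  ext1 w
  have hw : α.commPairing w ⁅x, y⁆ = 1 := by
    simpa only [hpair hx y w, hpair hy w x, mul_one] using
      α.commPairing_jacobi (hcen x y) (hcen y w) (hcen w x)
  rw [hα, MonoidHom.one_apply]
  exact α.commPairing_eq_one_of_mem_zpowers (mem_center_iff.mp (hcen x y) w) hw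
    (mem_zpowers_of_orderOf_eq_prime ho (hmem x y) hxy)

theorem exists_injective_eval_range_pairing :
    ∃ ev : (pairing R hz).range → rootsOfUnity p R × rootsOfUnity p R, Function.Injective ev ∧
      ∀ χ, ((ev χ).1 : Rˣ) = χ.1 x ∧ ((ev χ).2 : Rˣ) = χ.1 y := by
  have hroot (χ : (pairing R hz).range) (g : G) : χ.1 g ∈ rootsOfUnity p R :=
    (mem_rootsOfUnity _ _).mpr (ho ▸ pow_orderOf_eq_one_of_mem_range_pairing χ.2 g)
  refine ⟨fun χ => (⟨χ.1 x, hroot χ x⟩, ⟨χ.1 y, hroot χ y⟩), fun χ ψ h => ?_, fun χ => ⟨rfl, rfl⟩⟩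
  obtain ⟨hx, hy⟩ : χ.1 x = ψ.1 x ∧ χ.1 y = ψ.1 y := by
    simpa only [Prod.mk.injEq, Subtype.mk.injEq] using h
  refine Subtype.ext (div_eq_one.mp ?_)
  exact eq_one_of_mem_range_pairing hz ho hG' hxy (div_mem χ.2 ψ.2)
    (div_eq_one.mpr hx) (div_eq_one.mpr hy)

end Pairing

variable {K : Type} [Field K] [IsAlgClosed K] [CharZero K]

theorem card_range_pairing_le_sq (ho : orderOf z = p) (hG' : commutator G = zpowers z) {x y : G}
    (hxy : ⁅x, y⁆ ≠ 1) : Nat.card (pairing K hz).range ≤ p ^ 2 := by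
  have : NeZero p := ⟨(Fact.out : p.Prime).ne_zero⟩
  obtain ⟨ev, hev, -⟩ := exists_injective_eval_range_pairing (R := K) hz ho hG' hxy
  refine (Nat.card_le_card_of_injective ev hev).trans_eq ?_
  rw [Nat.card_prod, card_rootsOfUnity_prime, sq]

theorem exists_mem_range_pairing_apply_eq (ho : orderOf z = p) (hG' : commutator G = zpowers z)
    {x y : G} (hxy : ⁅x, y⁆ ≠ 1) (hc : p ^ 2 ≤ Nat.card (pairing K hz).range) {a b : Kˣ}
    (ha : a ^ p = 1) (hb : b ^ p = 1) : ∃ χ ∈ (pairing K hz).range, χ x = a ∧ χ y = b := by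
  have : NeZero p := ⟨(Fact.out : p.Prime).ne_zero⟩
  obtain ⟨ev, hev, hval⟩ := exists_injective_eval_range_pairing (R := K) hz ho hG' hxy
  have hcard : Nat.card (rootsOfUnity p K × rootsOfUnity p K) ≤ Nat.card (pairing K hz).range := by
    rwa [Nat.card_prod, card_rootsOfUnity_prime, ← sq]
  obtain ⟨χ, hχ⟩ := (hev.bijective_of_nat_card_le hcard).2
    (⟨a, (mem_rootsOfUnity _ _).mpr ha⟩, ⟨b, (mem_rootsOfUnity _ _).mpr hb⟩)
  exact ⟨χ.1, χ.2, by rw [← (hval χ).1, hχ], by rw [← (hval χ).2, hχ]⟩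

omit [Fact p.Prime] in
theorem mul_card_le_card_abelianization_mul [Finite G] (ho : orderOf z = p)
    (hG' : commutator G = zpowers z) :
    p * Nat.card (SecondCohomology K G) ≤
      Nat.card (SecondCohomology K (Abelianization G)) * Nat.card (pairing K hz).range := by
  have hquot : ∀ (N : Subgroup G) [N.Normal], N = zpowers z →
      p * Nat.card (SecondCohomology K G) ≤
        Nat.card (SecondCohomology K (G ⧸ N)) * Nat.card (pairing K hz).range := by
    rintro _ _ rfl
    exact ho ▸ orderOf_mul_card_le hz (hG' ▸ mem_zpowers z)
  exact hquot (commutator G) hG'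

omit hz in
theorem card_abelianization_of_commutator_eq_zpowers {n : ℕ} (hG : Nat.card G = p ^ (n + 1))
    (ho : orderOf z = p) (hG' : commutator G = zpowers z) :
    Nat.card (Abelianization G) = p ^ n := by
  rw [← card_quotient_zpowers_of_orderOf_eq_prime hG ho, ← hG', Abelianization]

end CommutatorPrime

variable {G : Type} [Group G] {K : Type} [Field K] [IsAlgClosed K] [CharZero K] {p : ℕ}
  [Fact p.Prime]

theorem card_range_pairing_le_index_commutator [Finite G] {z : G} (hz : z ∈ center G) :
    Nat.card (pairing K hz).range ≤ (commutator G).index := by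
  have := finite_characters K G
  exact (card_le_card_group _).trans_eq (card_characters K G)

theorem card_le_of_card_commutator_eq_prime {n : ℕ} (hG : Nat.card G = p ^ (n + 1))
    (hp' : Nat.card (commutator G) = p) :
    Nat.card (SecondCohomology K G) ≤ p ^ (n.choose 2 + 1) := by
  have hp : p.Prime := Fact.out
  have : Finite G := Nat.finite_of_card_ne_zero (hG ▸ pow_ne_zero _ hp.ne_zero)
  obtain ⟨z, hz, ho, hG'⟩ := exists_eq_zpowers_of_card_eq_prime (IsPGroup.of_card hG) hp'
  obtain ⟨x, y, hxy⟩ := exists_commutatorElement_ne_one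
    (ne_bot_of_card_eq_prime_pow_succ (hp'.trans (pow_one p).symm))
  refine Nat.le_of_mul_le_mul_left ?_ hp.pos
  calc p * Nat.card (SecondCohomology K G)
      ≤ Nat.card (SecondCohomology K (Abelianization G)) * Nat.card (pairing K hz).range :=
        mul_card_le_card_abelianization_mul hz ho hG'
    _ ≤ p ^ n.choose 2 * p ^ 2 :=
        Nat.mul_le_mul (card_le_pow_choose_two K <|
          card_abelianization_of_commutator_eq_zpowers hG ho hG')
          (card_range_pairing_le_sq hz ho hG' hxy)
    _ = p * p ^ (n.choose 2 + 1) := by ring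

theorem pow_mul_card_le_of_card_commutator {n k : ℕ} (hG : Nat.card G = p ^ (n + 1))
    (hk : Nat.card (commutator G) = p ^ (k + 1)) :
    p ^ k * Nat.card (SecondCohomology K G) ≤ p ^ (n.choose 2 + 1) := by
  have hp : p.Prime := Fact.out
  have : Finite G := Nat.finite_of_card_ne_zero (hG ▸ pow_ne_zero _ hp.ne_zero)
  induction k generalizing n G with
  | zero =>
    rw [pow_zero, one_mul]
    exact card_le_of_card_commutator_eq_prime hG (by rwa [zero_add, pow_one] at hk)
  | succ k ih =>
    obtain ⟨z, hz', hz, ho⟩ := exists_mem_center_orderOf_eq_prime (IsPGroup.of_card hG)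
      (ne_bot_of_card_eq_prime_pow_succ hk)
    have : (zpowers z).Normal := normal_of_le_center (zpowers_le.mpr hz)
    have hQ : Nat.card (G ⧸ zpowers z) = p ^ n := card_quotient_zpowers_of_orderOf_eq_prime hG ho
    have hkQ := card_commutator_quotient_zpowers hk ho hz'
    have hindex : p ^ (k + 2) * (commutator G).index = p ^ (n + 1) := by
      rw [← hG, ← card_mul_index (commutator G), hk]
    obtain ⟨m, rfl⟩ : ∃ m, n = m + 1 := Nat.exists_eq_add_one.mpr <| by
      have hdvd := (Nat.pow_dvd_pow_iff_le_right hp.one_lt).mp (Dvd.intro _ hindex)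
      omega
    refine Nat.le_of_mul_le_mul_left ?_ (pow_pos hp.pos 2)
    calc p ^ 2 * (p ^ (k + 1) * Nat.card (SecondCohomology K G))
        = p ^ (k + 2) * (p * Nat.card (SecondCohomology K G)) := by ring
      _ ≤ p ^ (k + 2) * (Nat.card (SecondCohomology K (G ⧸ zpowers z)) * (commutator G).index) :=
          Nat.mul_le_mul_left _ <| (ho ▸ orderOf_mul_card_le hz hz').trans <|
            Nat.mul_le_mul_left _ (card_range_pairing_le_index_commutator hz)
      _ = Nat.card (SecondCohomology K (G ⧸ zpowers z)) * p ^ (m + 2) := by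
          rw [mul_left_comm, hindex]
      _ ≤ p ^ (m.choose 2 + 1) * p ^ (m + 2) := Nat.mul_le_mul_right _ <|
          (Nat.le_mul_of_pos_left _ (pow_pos hp.pos k)).trans (ih hQ hkQ inferInstance)
      _ = p ^ 2 * p ^ ((m + 1).choose 2 + 1) := by
          rw [Nat.choose_succ_succ' m 1, Nat.choose_one_right]
          ring

end SecondCohomology

section ClassTwo

variable {G : Type} [Group G] (hG : commutator G ≤ center G)

theorem mul_eq_commutatorElement_mul (x y : G) : x * y = ⁅x, y⁆ * (y * x) := by
  rw [commutatorElement_def]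
  group

include hG in
theorem commutatorElement_commute (x y g : G) : Commute ⁅x, y⁆ g :=
  (mem_center_iff.mp (hG (commutatorElement_mem_commutator x y)) g).symm

/-- In a group of nilpotency class at most two, the commutator `⁅u, ·⁆` is an endomorphism. -/
def commutatorHom (u : G) : G →* G :=
  MonoidHom.mk' (fun g => ⁅u, g⁆) fun g h => by
    rw [commutatorElement_mul_right_eq_mul_conj, mul_assoc ⁅u, g⁆ g,
      ← (commutatorElement_commute hG u h g).eq, ← mul_assoc, mul_inv_cancel_right]

theorem commutatorHom_apply (u g : G) : commutatorHom hG u g = ⁅u, g⁆ := rfl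

include hG in
theorem commutatorElement_zpow_right (x y : G) (i : ℤ) : ⁅x, y ^ i⁆ = ⁅x, y⁆ ^ i :=
  map_zpow (commutatorHom hG x) y i

include hG in
theorem commutatorElement_zpow_left (x y : G) (i : ℤ) : ⁅x ^ i, y⁆ = ⁅x, y⁆ ^ i := by
  rw [← commutatorElement_inv, commutatorElement_zpow_right hG, ← inv_zpow, commutatorElement_inv]

include hG in
theorem zpow_mul_zpow_eq (x y : G) (i j : ℤ) :
    x ^ i * y ^ j = ⁅x, y⁆ ^ (i * j) * (y ^ j * x ^ i) := by
  rw [mul_eq_commutatorElement_mul, commutatorElement_zpow_left hG, commutatorElement_zpow_right hG,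
    ← zpow_mul, mul_comm i j]

include hG in
theorem mul_pow_eq (x y : G) (k : ℕ) : (y * x) ^ k = ⁅x, y⁆ ^ k.choose 2 * (y ^ k * x ^ k) := by
  induction k with
  | zero => simp only [pow_zero, Nat.choose_zero_succ, mul_one]
  | succ k ih =>
    have hswap : x ^ k * y = ⁅x, y⁆ ^ k * (y * x ^ k) := by
      simpa only [zpow_natCast, zpow_one, mul_one] using zpow_mul_zpow_eq hG x y k 1
    calc (y * x) ^ (k + 1) = ⁅x, y⁆ ^ k.choose 2 * y ^ k * (x ^ k * y) * x := by
          rw [pow_succ, ih]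
          group
      _ = ⁅x, y⁆ ^ k.choose 2 * (y ^ k * ⁅x, y⁆ ^ k) * y * x ^ k * x := by
          rw [hswap]
          group
      _ = ⁅x, y⁆ ^ k.choose 2 * (⁅x, y⁆ ^ k * y ^ k) * y * x ^ k * x := by
          rw [((commutatorElement_commute hG x y _).pow_left k).eq]
      _ = ⁅x, y⁆ ^ (k + 1).choose 2 * (y ^ (k + 1) * x ^ (k + 1)) := by
          rw [Nat.choose_succ_succ' k 1, Nat.choose_one_right, add_comm k, pow_add, pow_succ y,
            pow_succ x]
          group

include hG in
theorem pow_eq_one_of_mem_commutator {p : ℕ} (hpow : ∀ x : G, x ^ p ∈ center G) {d : G}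
    (hd : d ∈ commutator G) : d ^ p = 1 := by
  rw [commutator_eq_closure] at hd
  induction hd using closure_induction with
  | mem _ hx =>
    obtain ⟨x, y, rfl⟩ := hx
    exact (map_pow (commutatorHom hG x) y p).symm.trans
      (commutatorElement_eq_one_iff_mul_comm.mpr (mem_center_iff.mp (hpow y) x))
  | one => exact one_pow p
  | mul x y hx _ ihx ihy =>
    rw [← commutator_eq_closure] at hx
    rw [Commute.mul_pow (mem_center_iff.mp (hG hx) y).symm, ihx, ihy, mul_one]
  | inv x _ ih => rw [inv_pow, ih, inv_one]

include hG in
theorem commutatorElement_mul_zpow_mul_zpow {a b c : G} (hc : c ∈ center G) (g : G) (i j : ℤ) :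
    ⁅g, c * b ^ i * a ^ j⁆ = ⁅g, b⁆ ^ i * ⁅g, a⁆ ^ j := by
  have hgc : commutatorHom hG g c = 1 :=
    commutatorElement_eq_one_iff_mul_comm.mpr (mem_center_iff.mp hc g)
  rw [← commutatorHom_apply hG, map_mul, map_mul, map_zpow, map_zpow, hgc, one_mul,
    commutatorHom_apply, commutatorHom_apply]

include hG in
theorem commutator_le_zpowers {a b : G}
    (hgen : ∀ g : G, ∃ c ∈ center G, ∃ i j : ℤ, g = c * b ^ i * a ^ j) :
    commutator G ≤ zpowers ⁅a, b⁆ := by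
  have hb (g : G) : ⁅g, b⁆ ∈ zpowers ⁅a, b⁆ := by
    obtain ⟨c, hc, i, j, rfl⟩ := hgen g
    rw [← commutatorElement_inv b (c * b ^ i * a ^ j),
      commutatorElement_mul_zpow_mul_zpow hG hc, commutatorElement_self, one_zpow, one_mul,
      ← commutatorElement_inv a b]
    exact inv_mem (zpow_mem (inv_mem (mem_zpowers _)) j)
  have ha (g : G) : ⁅g, a⁆ ∈ zpowers ⁅a, b⁆ := by
    obtain ⟨c, hc, i, j, rfl⟩ := hgen g
    rw [← commutatorElement_inv a (c * b ^ i * a ^ j),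
      commutatorElement_mul_zpow_mul_zpow hG hc, commutatorElement_self, one_zpow, mul_one]
    exact inv_mem (zpow_mem (mem_zpowers _) i)
  refine (commutator_le (H₁ := ⊤) (H₂ := ⊤)).mpr fun g _ h _ => ?_
  obtain ⟨c, hc, i, j, rfl⟩ := hgen h
  rw [commutatorElement_mul_zpow_mul_zpow hG hc]
  exact mul_mem (zpow_mem (hb g) i) (zpow_mem (ha g) j)

end ClassTwo

section Parametrization

variable {X G H : Type} [Group G] [Group H] {f : X → G} {f' : X → H}

theorem eq_of_parametrization (hf : Function.Surjective f)
    (hmul : ∀ x y, ∃ w, f w = f x * f y ∧ f' w = f' x * f' y) (hone : ∀ x, f x = 1 → f' x = 1)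
    {x y : X} (h : f x = f y) : f' x = f' y := by
  obtain ⟨v, hv⟩ := hf (f y)⁻¹
  have hinv {u : X} (hu : f u = f y) : f' u * f' v = 1 := by
    obtain ⟨w, hw, hw'⟩ := hmul u v
    rw [← hw']
    exact hone w (by rw [hw, hu, hv, mul_inv_cancel])
  exact mul_right_cancel ((hinv h).trans (hinv rfl).symm)

theorem nonempty_mulEquiv_of_parametrization (hf : Function.Surjective f)
    (hf' : Function.Surjective f') (hmul : ∀ x y, ∃ w, f w = f x * f y ∧ f' w = f' x * f' y)
    (hone : ∀ x, f x = 1 ↔ f' x = 1) : Nonempty (G ≃* H) := by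
  have hlift (x : X) : f' (Function.surjInv hf (f x)) = f' x :=
    eq_of_parametrization hf hmul (fun x => (hone x).mp) (Function.surjInv_eq hf (f x))
  refine ⟨MulEquiv.ofBijective (MonoidHom.mk' (fun g => f' (Function.surjInv hf g)) ?_) ⟨?_, ?_⟩⟩
  · intro g h
    obtain ⟨w, hw, hw'⟩ := hmul (Function.surjInv hf g) (Function.surjInv hf h)
    rw [← hw', ← hlift w, hw, Function.surjInv_eq hf, Function.surjInv_eq hf]
  · intro g h hgh
    have heq : f (Function.surjInv hf g) = f (Function.surjInv hf h) :=
      eq_of_parametrization hf' (fun x y => (hmul x y).imp fun _ => And.symm)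
        (fun x => (hone x).mpr) hgh
    rwa [Function.surjInv_eq hf, Function.surjInv_eq hf] at heq
  · intro h
    obtain ⟨x, rfl⟩ := hf' h
    exact ⟨f x, hlift x⟩

end Parametrization

section ElementaryAbelian

variable {F V W : Type} [Field F] [AddCommGroup V] [AddCommGroup W] [Module F V] [Module F W]

theorem nonempty_linearEquiv_of_card_eq [Finite F] [Finite V] [Finite W]
    (hc : Nat.card V = Nat.card W) : Nonempty (V ≃ₗ[F] W) := by
  rw [Module.natCard_eq_pow_finrank (K := F) (V := V),
    Module.natCard_eq_pow_finrank (K := F) (V := W)] at hc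
  exact ⟨LinearEquiv.ofFinrankEq V W (Nat.pow_right_injective (Finite.one_lt_card (α := F)) hc)⟩

theorem exists_linearEquiv_apply_eq [Finite F] [Finite V] [Finite W]
    (hc : Nat.card V = Nat.card W) {v : V} {w : W} (hv : v ≠ 0) (hw : w ≠ 0) :
    ∃ e : V ≃ₗ[F] W, e v = w := by
  obtain ⟨e⟩ := nonempty_linearEquiv_of_card_eq (F := F) hc
  have hev : e v ≠ 0 := mt e.map_eq_zero_iff.mp hv
  obtain ⟨g, hg⟩ := Submodule.exists_linearEquiv_restrict_eq
    ((LinearEquiv.toSpanNonzeroSingleton F W _ hev).symm.trans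
      (LinearEquiv.toSpanNonzeroSingleton F W _ hw))
  refine ⟨e.trans g, ?_⟩
  have h1 := hg (LinearEquiv.toSpanNonzeroSingleton F W _ hev 1)
  rw [LinearEquiv.trans_apply, LinearEquiv.symm_apply_apply,
    LinearEquiv.toSpanNonzeroSingleton_one, LinearEquiv.toSpanNonzeroSingleton_one] at h1
  exact h1.symm

theorem exists_mulEquiv_apply_eq {p : ℕ} [Fact p.Prime] {A B : Type} [CommGroup A] [CommGroup B]
    [Finite A] [Finite B] (hA : ∀ a : A, a ^ p = 1) (hB : ∀ b : B, b ^ p = 1)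
    (hc : Nat.card A = Nat.card B) {a : A} {b : B} (ha : a ≠ 1) (hb : b ≠ 1) :
    ∃ e : A ≃* B, e a = b := by
  let _ : Module (ZMod p) (Additive A) := AddCommGroup.zmodModule fun x => hA x.toMul
  let _ : Module (ZMod p) (Additive B) := AddCommGroup.zmodModule fun x => hB x.toMul
  obtain ⟨e, he⟩ := exists_linearEquiv_apply_eq (F := ZMod p) (V := Additive A) (W := Additive B)
    hc (v := Additive.ofMul a) (w := Additive.ofMul b) ha hb
  exact ⟨MulEquiv.toAdditive.symm e.toAddEquiv, he⟩

end ElementaryAbelian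

/-- The groups `C ∘ ⟨a, b⟩` in which a center `C` of exponent `p` is extended by two elements
`a`, `b` whose commutator is central and nontrivial. For `p` odd they are the products of an
elementary abelian group and a Heisenberg group of order `p ^ 3`; the relation on `b * a` in place
of one on `b` covers the dihedral group for `p = 2`. -/
structure IsHeisenbergType {G : Type} [Group G] (p : ℕ) (a b : G) : Prop where
  commutator_le : commutator G ≤ center G
  pow_eq_one : ∀ c ∈ center G, c ^ p = 1
  commutatorElement_ne_one : ⁅a, b⁆ ≠ 1
  a_pow : a ^ p = 1
  mul_pow : (b * a) ^ p = 1
  exists_eq : ∀ g, ∃ c ∈ center G, ∃ i j : ℤ, g = c * b ^ i * a ^ j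

namespace IsHeisenbergType

variable {G : Type} [Group G] {p : ℕ} {a b : G} (h : IsHeisenbergType p a b)
include h

theorem commutatorElement_mem_center : ⁅a, b⁆ ∈ center G :=
  h.commutator_le (commutatorElement_mem_commutator a b)

theorem b_pow : b ^ p = (⁅a, b⁆ ^ p.choose 2)⁻¹ := by
  have hba := h.mul_pow
  rw [mul_pow_eq h.commutator_le, h.a_pow, mul_one] at hba
  exact eq_inv_of_mul_eq_one_right hba

theorem a_zpow (k : ℤ) : a ^ (p * k : ℤ) = 1 := by
  rw [zpow_mul, zpow_natCast, h.a_pow, one_zpow]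

theorem b_zpow (k : ℤ) : b ^ (p * k : ℤ) = ⁅a, b⁆ ^ (-(p.choose 2) * k : ℤ) := by
  rw [zpow_mul, zpow_natCast, h.b_pow, zpow_mul, zpow_neg, zpow_natCast]

theorem mul_mul_eq {c d : G} (hd : d ∈ center G) (i j k l : ℤ) :
    (c * b ^ i * a ^ j) * (d * b ^ k * a ^ l) =
      (c * d * ⁅a, b⁆ ^ (j * k)) * b ^ (i + k) * a ^ (j + l) := by
  have hab := zpow_mem h.commutatorElement_mem_center (j * k)
  calc _ = c * ((b ^ i * a ^ j) * d) * b ^ k * a ^ l := by simp only [mul_assoc]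
    _ = c * d * b ^ i * (a ^ j * b ^ k) * a ^ l := by
      rw [mem_center_iff.mp hd]
      simp only [mul_assoc]
    _ = c * d * (b ^ i * ⁅a, b⁆ ^ (j * k)) * (b ^ k * a ^ j) * a ^ l := by
      rw [zpow_mul_zpow_eq h.commutator_le]
      simp only [mul_assoc]
    _ = _ := by
      rw [mem_center_iff.mp hab, zpow_add, zpow_add]
      simp only [mul_assoc]

theorem mem_center_of_commutatorElement_eq_one {g : G} (ha : ⁅a, g⁆ = 1) (hb : ⁅b, g⁆ = 1) :
    g ∈ center G := by
  refine mem_center_iff.mpr fun x => ?_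
  obtain ⟨c, hc, i, j, rfl⟩ := h.exists_eq x
  rw [← commutatorElement_eq_one_iff_mul_comm, ← commutatorElement_inv g,
    commutatorElement_mul_zpow_mul_zpow h.commutator_le hc, ← commutatorElement_inv b g,
    ← commutatorElement_inv a g, ha, hb, inv_one, one_zpow, one_zpow, one_mul, inv_one]

variable [hp : Fact p.Prime]

theorem orderOf_commutatorElement : orderOf ⁅a, b⁆ = p :=
  orderOf_eq_prime (h.pow_eq_one _ h.commutatorElement_mem_center) h.commutatorElement_ne_one

theorem dvd_of_mem_center {c : G} (hc : c ∈ center G) {i j : ℤ}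
    (hg : c * b ^ i * a ^ j ∈ center G) : (p : ℤ) ∣ i ∧ (p : ℤ) ∣ j := by
  have hcomm (x : G) : ⁅x, b⁆ ^ i * ⁅x, a⁆ ^ j = 1 := by
    rw [← commutatorElement_mul_zpow_mul_zpow h.commutator_le hc]
    exact commutatorElement_eq_one_iff_mul_comm.mpr (mem_center_iff.mp hg x)
  have ha := hcomm a
  have hb := hcomm b
  rw [commutatorElement_self, one_zpow, mul_one] at ha
  rw [commutatorElement_self, one_zpow, one_mul, ← commutatorElement_inv, inv_zpow,
    inv_eq_one] at hb
  rw [← h.orderOf_commutatorElement]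
  exact ⟨orderOf_dvd_iff_zpow_eq_one.mpr ha, orderOf_dvd_iff_zpow_eq_one.mpr hb⟩

theorem card_center_mul : Nat.card (center G) * p ^ 2 = Nat.card G := by
  let φ : G →* G × G := (commutatorHom h.commutator_le a).prod (commutatorHom h.commutator_le b)
  have hφ (g : G) : φ g = (⁅a, g⁆, ⁅b, g⁆) := rfl
  have hker : φ.ker = center G := by
    ext g
    rw [MonoidHom.mem_ker, hφ, Prod.mk_eq_one]
    refine ⟨fun hg => h.mem_center_of_commutatorElement_eq_one hg.1 hg.2, fun hg => ?_⟩
    simp only [commutatorElement_eq_one_iff_mul_comm, mem_center_iff.mp hg, and_self]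
  have hrange : φ.range = (zpowers ⁅a, b⁆).prod (zpowers ⁅b, a⁆) := by
    ext ⟨u, v⟩
    constructor
    · rintro ⟨g, hg⟩
      obtain ⟨c, hc, i, j, rfl⟩ := h.exists_eq g
      rw [hφ, commutatorElement_mul_zpow_mul_zpow h.commutator_le hc,
        commutatorElement_mul_zpow_mul_zpow h.commutator_le hc, commutatorElement_self,
        commutatorElement_self, one_zpow, one_zpow, mul_one, one_mul, Prod.mk.injEq] at hg
      exact mem_prod.mpr ⟨⟨i, hg.1⟩, ⟨j, hg.2⟩⟩
    · rintro ⟨⟨i, hi⟩, ⟨j, hj⟩⟩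
      refine ⟨1 * b ^ i * a ^ j, ?_⟩
      rw [hφ, commutatorElement_mul_zpow_mul_zpow h.commutator_le (one_mem _),
        commutatorElement_mul_zpow_mul_zpow h.commutator_le (one_mem _), commutatorElement_self,
        commutatorElement_self, one_zpow, one_zpow, mul_one, one_mul]
      exact Prod.ext hi hj
  have hba : orderOf ⁅b, a⁆ = p := by
    rw [← commutatorElement_inv, orderOf_inv, h.orderOf_commutatorElement]
  rw [← card_mul_index (center G), ← hker, index_ker, hrange, hker,
    Nat.card_congr (prodEquiv _ _).toEquiv, Nat.card_prod, Nat.card_zpowers, Nat.card_zpowers, hba,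
    h.orderOf_commutatorElement, sq]

theorem mul_zpow_mul_zpow_eq_one {H : Type} [Group H] {a' b' : H} (h' : IsHeisenbergType p a' b')
    {θ : center G →* center H} (hθ : (θ ⟨⁅a, b⁆, h.commutatorElement_mem_center⟩ : H) = ⁅a', b'⁆)
    {c : center G} {i j : ℤ} (he : (c : G) * b ^ i * a ^ j = 1) :
    (θ c : H) * b' ^ i * a' ^ j = 1 := by
  obtain ⟨⟨k, rfl⟩, ⟨l, rfl⟩⟩ := h.dvd_of_mem_center c.2 (he ▸ one_mem _)
  rw [h.b_zpow, h.a_zpow, mul_one] at he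
  have hc : c * ⟨⁅a, b⁆, h.commutatorElement_mem_center⟩ ^ (-(p.choose 2) * k : ℤ) = 1 :=
    Subtype.ext he
  have hθc := congrArg (fun x => (θ x : H)) hc
  simp only [map_mul, map_zpow, map_one, Subgroup.coe_mul, Subgroup.coe_zpow, Subgroup.coe_one,
    hθ] at hθc
  rw [h'.b_zpow, h'.a_zpow, mul_one, hθc]

open scoped IsMulCommutative in
theorem nonempty_mulEquiv [Finite G] {H : Type} [Group H] [Finite H] {a' b' : H}
    (h' : IsHeisenbergType p a' b') (hc : Nat.card G = Nat.card H) : Nonempty (G ≃* H) := by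
  rw [← h.card_center_mul, ← h'.card_center_mul] at hc
  obtain ⟨θ, hθ⟩ := exists_mulEquiv_apply_eq
    (fun x : center G => Subtype.ext (h.pow_eq_one x x.2))
    (fun x : center H => Subtype.ext (h'.pow_eq_one x x.2))
    (Nat.eq_of_mul_eq_mul_right (pow_pos hp.out.pos 2) hc)
    (a := ⟨⁅a, b⁆, h.commutatorElement_mem_center⟩)
    (b := ⟨⁅a', b'⁆, h'.commutatorElement_mem_center⟩)
    (fun e => h.commutatorElement_ne_one (congrArg Subtype.val e))
    (fun e => h'.commutatorElement_ne_one (congrArg Subtype.val e))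
  refine nonempty_mulEquiv_of_parametrization (X := center G × ℤ × ℤ)
    (f := fun x => (x.1 : G) * b ^ x.2.1 * a ^ x.2.2)
    (f' := fun x => (θ x.1 : H) * b' ^ x.2.1 * a' ^ x.2.2) ?_ ?_ ?_ fun x => ⟨?_, ?_⟩
  · intro g
    obtain ⟨c, hc, i, j, rfl⟩ := h.exists_eq g
    exact ⟨(⟨c, hc⟩, i, j), rfl⟩
  · intro g
    obtain ⟨c, hc, i, j, rfl⟩ := h'.exists_eq g
    exact ⟨(θ.symm ⟨c, hc⟩, i, j), by simp only [θ.apply_symm_apply]⟩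
  · rintro ⟨c, i, j⟩ ⟨d, k, l⟩
    refine ⟨(c * d * ⟨⁅a, b⁆, h.commutatorElement_mem_center⟩ ^ (j * k), i + k, j + l), ?_, ?_⟩
    · exact (h.mul_mul_eq d.2 i j k l).symm
    · rw [h'.mul_mul_eq (θ d).2, map_mul, map_mul, map_zpow, hθ]
      rfl
  · exact h.mul_zpow_mul_zpow_eq_one h' (θ := θ.toMonoidHom) (congrArg Subtype.val hθ)
  · intro hx
    have hθ' := congrArg Subtype.val (θ.symm_apply_eq.mpr hθ.symm)
    have := h'.mul_zpow_mul_zpow_eq_one h (θ := θ.symm.toMonoidHom) hθ' hx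
    rwa [MulEquiv.coe_toMonoidHom, θ.symm_apply_apply] at this

theorem pow_eq_one_of_ne_two (hp2 : p ≠ 2) (g : G) : g ^ p = 1 := by
  have hdvd : p ∣ p.choose 2 :=
    hp.out.dvd_choose_self two_ne_zero (lt_of_le_of_ne hp.out.two_le hp2.symm)
  have hcomm {d : G} (hd : d ∈ commutator G) : d ^ p.choose 2 = 1 :=
    orderOf_dvd_iff_pow_eq_one.mp
      ((orderOf_dvd_of_pow_eq_one (h.pow_eq_one d (h.commutator_le hd))).trans hdvd)
  have hb : b ^ p = 1 := by
    rw [h.b_pow, hcomm (commutatorElement_mem_commutator a b), inv_one]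
  have hzpow {x : G} (hx : x ^ p = 1) (i : ℤ) : (x ^ i) ^ p = 1 := by
    rw [← zpow_natCast, zpow_comm, zpow_natCast, hx, one_zpow]
  obtain ⟨c, hc, i, j, rfl⟩ := h.exists_eq g
  rw [mul_assoc, Commute.mul_pow (mem_center_iff.mp hc _).symm, h.pow_eq_one c hc,
    mul_pow_eq h.commutator_le, hcomm (commutatorElement_mem_commutator _ _), hzpow hb,
    hzpow h.a_pow, one_mul, one_mul, one_mul]

end IsHeisenbergType

section Character

variable {K : Type} [Field K] {G : Type} [Group G] {p : ℕ} [hp : Fact p.Prime]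

theorem mem_zpowers_of_pow_eq_one [IsAlgClosed K] [CharZero K] {u v : Kˣ} (hu : u ^ p = 1)
    (hv : v ^ p = 1) (hu1 : u ≠ 1) : v ∈ zpowers u := by
  obtain ⟨i, hi⟩ : (⟨v, hv⟩ : rootsOfUnity p K) ∈ zpowers ⟨u, hu⟩ :=
    mem_zpowers_of_prime_card (card_rootsOfUnity_prime K p) (mt (congrArg Subtype.val) hu1)
  exact ⟨i, congrArg Subtype.val hi⟩

variable {χ : G →* Kˣ} {a : G}

theorem exists_eq_mul_zpow_of_character [IsAlgClosed K] [CharZero K] (hpow : ∀ g, χ g ^ p = 1)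
    (ha : χ a ≠ 1) (g : G) : ∃ n, χ n = 1 ∧ ∃ j : ℤ, g = n * a ^ j := by
  obtain ⟨j, hj⟩ := mem_zpowers_iff.mp (mem_zpowers_of_pow_eq_one (hpow a) (hpow g) ha)
  refine ⟨g * (a ^ j)⁻¹, ?_, j, (inv_mul_cancel_right g (a ^ j)).symm⟩
  rw [map_mul, map_inv, map_zpow, hj, mul_inv_cancel]

theorem exists_commutatorElement_ne_one_of_character [Finite G] (hG' : commutator G ≠ ⊥)
    (hrep : ∀ g, ∃ n, χ n = 1 ∧ ∃ j : ℤ, g = n * a ^ j)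
    (hker : ∀ x y, χ x = 1 → χ y = 1 → Commute x y) : ∃ b, χ b = 1 ∧ ⁅a, b⁆ ≠ 1 := by
  by_contra! hab
  have hle : χ.ker ≤ center G := fun c hc => mem_center_iff.mpr fun g => by
    obtain ⟨n, hn, j, rfl⟩ := hrep g
    have hac : Commute a c := commutatorElement_eq_one_iff_commute.mp (hab c hc)
    exact (hker n c hn hc).mul_left (hac.zpow_left j)
  have : Finite χ.range := Finite.of_surjective _ χ.rangeRestrict_surjective
  have hcyclic : IsCyclic χ.range := isCyclic_subgroup_units χ.range
  have hcomm := χ.rangeRestrict.isMulCommutative_of_isCyclic_of_ker_le_center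
    (χ.ker_rangeRestrict.trans_le hle)
  exact hG' ((_root_.commutator_eq_bot_iff G).mpr hcomm)

theorem exists_isHeisenbergType_of_character [IsAlgClosed K] [CharZero K] [Finite G]
    (hG' : commutator G ≤ center G) (hcard : Nat.card (commutator G) = p)
    (hχ : χ ≠ 1) (hpow : ∀ g, χ g ^ p = 1) (hker : ∀ x y, χ x = 1 → χ y = 1 → Commute x y)
    (hout : ∀ g, χ g ≠ 1 → g ^ p = 1) : ∃ a b : G, IsHeisenbergType p a b := by
  obtain ⟨a, ha⟩ := DFunLike.ne_iff.mp hχ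
  rw [MonoidHom.one_apply] at ha
  have hrep := exists_eq_mul_zpow_of_character hpow ha
  have hne : commutator G ≠ ⊥ := ne_bot_of_card_eq_prime_pow_succ (p := p) (k := 0)
    (by rw [hcard, zero_add, pow_one])
  obtain ⟨b, hb, hab⟩ := exists_commutatorElement_ne_one_of_character hne hrep hker
  have hmem (u v : G) : ⁅u, v⁆ ∈ commutator G := commutatorElement_mem_commutator u v
  have hcentral {c : G} (hc : χ c = 1) (hac : ⁅a, c⁆ = 1) : c ∈ center G :=
    mem_center_iff.mpr fun g => by
      obtain ⟨n, hn, j, rfl⟩ := hrep g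
      exact (hker n c hn hc).mul_left ((commutatorElement_eq_one_iff_commute.mp hac).zpow_left j)
  refine ⟨a, b, hG', fun c hc => ?_, hab, hout a ha, ?_, fun g => ?_⟩
  · by_cases hχc : χ c = 1
    · have hac := hout (a * c) (by rwa [map_mul, hχc, mul_one])
      rwa [Commute.mul_pow (mem_center_iff.mp hc a), hout a ha, one_mul] at hac
    · exact hout c hχc
  · exact hout (b * a) (by rwa [map_mul, hb, one_mul])
  · obtain ⟨n, hn, j, rfl⟩ := hrep g
    obtain ⟨i, hi⟩ : (⟨⁅a, n⁆, hmem a n⟩ : commutator G) ∈ zpowers ⟨⁅a, b⁆, hmem a b⟩ :=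
      mem_zpowers_of_prime_card hcard (mt (congrArg Subtype.val) hab)
    replace hi : ⁅a, b⁆ ^ i = ⁅a, n⁆ := congrArg Subtype.val hi
    refine ⟨n * (b ^ i)⁻¹, hcentral ?_ ?_, i, j, by rw [inv_mul_cancel_right]⟩
    · rw [map_mul, map_inv, map_zpow, hn, hb, one_zpow, inv_one, one_mul]
    · rw [← commutatorHom_apply hG', map_mul, map_inv, commutatorHom_apply, commutatorHom_apply,
        commutatorElement_zpow_right hG', hi, mul_inv_cancel]

end Character

theorem isCyclic_of_pow_ne_one {A : Type} [Group A] {p n : ℕ} [hp : Fact p.Prime]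
    (hA : Nat.card A = p ^ n) (hn : n ≤ 2) {y : A} (hy : y ^ p ≠ 1) : IsCyclic A := by
  obtain ⟨j, hj, hjo⟩ := (Nat.dvd_prime_pow hp.out).mp (hA ▸ orderOf_dvd_natCard y)
  have hj2 : 2 ≤ j := by
    by_contra! hlt
    refine hy (orderOf_dvd_iff_pow_eq_one.mp ?_)
    rw [hjo]
    exact (pow_dvd_pow p (Nat.le_of_lt_succ hlt)).trans (pow_one p).dvd
  have : Finite A := Nat.finite_of_card_ne_zero (hA ▸ pow_ne_zero _ hp.out.ne_zero)
  exact isCyclic_of_orderOf_eq_card y (by rw [hjo, hA, le_antisymm hj (hn.trans hj2)])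

namespace SecondCohomology

variable {G : Type} [Group G] {p : ℕ} [hp : Fact p.Prime]

theorem pow_eq_one_of_pairing_ne_one {R : Type} [CommRing R] {z : G} (hz : z ∈ center G)
    (ho : orderOf z = p) {χ : G →* Rˣ} (hχ : χ ∈ (pairing R hz).range) {x : G} (hx : χ x ≠ 1)
    (hxp : x ^ p ∈ zpowers z) : x ^ p = 1 := by
  obtain ⟨α, hα⟩ := exists_eq_commPairing_of_mem_range_pairing hχ
  by_contra h
  rw [hα] at hx
  refine hx (α.commPairing_eq_one_of_mem_zpowers (z := x ^ p) ?_ (α.commPairing_self_pow x p)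
    (mem_zpowers_of_orderOf_eq_prime ho hxp h))
  exact (Commute.refl x).pow_right p

variable {K : Type} [Field K] [IsAlgClosed K] [CharZero K]

theorem le_card_range_pairing [Finite G] {n e : ℕ} (hG : Nat.card G = p ^ (n + 1)) {z : G}
    (hz : z ∈ center G) (ho : orderOf z = p) (hG' : commutator G = zpowers z)
    (hM : p ^ (n.choose 2 + e) ≤ Nat.card (SecondCohomology K G)) :
    p ^ (e + 1) ≤ Nat.card (pairing K hz).range := by
  have hA := card_le_pow_choose_two K (card_abelianization_of_commutator_eq_zpowers hG ho hG')
  refine Nat.le_of_mul_le_mul_left ?_ (pow_pos hp.out.pos (n.choose 2))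
  calc p ^ n.choose 2 * p ^ (e + 1) = p * p ^ (n.choose 2 + e) := by ring
    _ ≤ p * Nat.card (SecondCohomology K G) := Nat.mul_le_mul_left p hM
    _ ≤ Nat.card (SecondCohomology K (Abelianization G)) * Nat.card (pairing K hz).range :=
      mul_card_le_card_abelianization_mul hz ho hG'
    _ ≤ p ^ n.choose 2 * Nat.card (pairing K hz).range := Nat.mul_le_mul_right _ hA

theorem pow_mem_commutator_of_card_le [Finite G] {n : ℕ} (hG : Nat.card G = p ^ (n + 1)) {z : G}
    (hz : z ∈ center G) (ho : orderOf z = p) (hG' : commutator G = zpowers z)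
    (hM : p ^ n.choose 2 ≤ Nat.card (SecondCohomology K G)) (y : G) : y ^ p ∈ commutator G := by
  by_contra hy
  have hyA : Abelianization.of y ^ p ≠ 1 := by
    rwa [← map_pow, Ne, ← MonoidHom.mem_ker, Abelianization.ker_of]
  have hne : commutator G ≠ ⊥ := by
    rw [hG', Ne, zpowers_eq_bot, ← orderOf_eq_one_iff, ho]
    exact hp.out.ne_one
  obtain ⟨u, v, huv⟩ := exists_commutatorElement_ne_one hne
  have hA := card_abelianization_of_commutator_eq_zpowers hG ho hG'
  rcases n with _ | m
  · have := (Nat.card_eq_one_iff_unique.mp hA).1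
    exact hyA (Subsingleton.elim _ _)
  have hm : m ≤ 1 := by
    have hle : p ^ (m + m.choose 2 + 1) ≤ p ^ (m.choose 2 + 2) := by
      calc p ^ (m + m.choose 2 + 1) = p * p ^ (m + 1).choose 2 := by
            rw [Nat.choose_succ_succ' m 1, Nat.choose_one_right, pow_succ']
        _ ≤ p * Nat.card (SecondCohomology K G) := Nat.mul_le_mul_left p hM
        _ ≤ _ := mul_card_le_card_abelianization_mul hz ho hG'
        _ ≤ p ^ m.choose 2 * p ^ 2 := Nat.mul_le_mul
            (card_le_pow_choose_two_of_pow_ne_one K hA hyA)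
            (card_range_pairing_le_sq hz ho hG' huv)
        _ = _ := (pow_add _ _ _).symm
    have := (Nat.pow_le_pow_iff_right hp.out.one_lt).mp hle
    omega
  have hcyclic : IsCyclic (Abelianization G) := isCyclic_of_pow_ne_one hA (by omega) hyA
  have hcomm := (Abelianization.of (G := G)).isMulCommutative_of_isCyclic_of_ker_le_center
    (by rw [Abelianization.ker_of, hG', zpowers_le]; exact hz)
  exact hne ((_root_.commutator_eq_bot_iff G).mpr hcomm)

theorem exists_isHeisenbergType_of_card_le {n : ℕ} (hG : Nat.card G = p ^ (n + 1))
    (hp' : Nat.card (commutator G) = p) (hM : p ^ n.choose 2 ≤ Nat.card (SecondCohomology K G)) :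
    ∃ a b : G, IsHeisenbergType p a b := by
  have : Finite G := Nat.finite_of_card_ne_zero (hG ▸ pow_ne_zero _ hp.out.ne_zero)
  obtain ⟨z, hz, ho, hG'⟩ := exists_eq_zpowers_of_card_eq_prime (IsPGroup.of_card hG) hp'
  have hr := le_card_range_pairing (e := 0) hG hz ho hG' hM
  obtain ⟨χ, hχ, hχ1⟩ := (pairing K hz).range.bot_or_exists_ne_one.resolve_left fun h => by
    rw [h, Subgroup.card_bot, zero_add, pow_one] at hr
    exact hp.out.one_lt.not_ge hr
  refine exists_isHeisenbergType_of_character (hG' ▸ zpowers_le.mpr hz) hp' hχ1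
    (fun g => ho ▸ pow_orderOf_eq_one_of_mem_range_pairing hχ g) (fun x y hx hy => ?_)
    fun g hg => pow_eq_one_of_pairing_ne_one hz ho hχ hg
      (hG' ▸ pow_mem_commutator_of_card_le hG hz ho hG' hM g)
  by_contra hxy
  exact hχ1 (eq_one_of_mem_range_pairing hz ho hG'
    (mt commutatorElement_eq_one_iff_commute.mp hxy) hχ hx hy)

theorem ne_two_of_card_le {n : ℕ} (hG : Nat.card G = p ^ (n + 1))
    (hp' : Nat.card (commutator G) = p)
    (hM : p ^ (n.choose 2 + 1) ≤ Nat.card (SecondCohomology K G)) : p ≠ 2 := by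
  rintro rfl
  have : Finite G := Nat.finite_of_card_ne_zero (hG ▸ pow_ne_zero _ two_ne_zero)
  obtain ⟨z, hz, ho, hG'⟩ := exists_eq_zpowers_of_card_eq_prime (IsPGroup.of_card hG) hp'
  have hsq {χ : G →* Kˣ} (hχ : χ ∈ (pairing K hz).range) {g : G} (hg : χ g = -1) : g * g = 1 := by
    rw [← sq]
    refine pow_eq_one_of_pairing_ne_one hz ho hχ (hg ▸ ?_)
      (hG' ▸ pow_mem_commutator_of_card_le hG hz ho hG'
        ((Nat.pow_le_pow_right two_pos (Nat.le_succ _)).trans hM) g)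
    exact mt (congrArg Units.val) (neg_ne_self.mpr one_ne_zero)
  obtain ⟨x, y, hxy⟩ := exists_commutatorElement_ne_one (G := G)
    (ne_bot_of_card_eq_prime_pow_succ (p := 2) (k := 0) hp')
  have hr := le_card_range_pairing (e := 1) hG hz ho hG' hM
  obtain ⟨χ, hχ, hχx, hχy⟩ := exists_mem_range_pairing_apply_eq hz ho hG' hxy hr (a := -1) (b := 1)
    neg_one_sq (one_pow 2)
  obtain ⟨ψ, hψ, hψx, hψy⟩ := exists_mem_range_pairing_apply_eq hz ho hG' hxy hr (a := 1) (b := -1)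
    (one_pow 2) neg_one_sq
  have hx : x⁻¹ = x := inv_eq_of_mul_eq_one_left (hsq hχ hχx)
  have hy : y⁻¹ = y := inv_eq_of_mul_eq_one_left (hsq hψ hψy)
  have hxy2 : x * y * (x * y) = 1 := hsq hχ (by rw [map_mul, hχx, hχy, mul_one])
  rw [commutatorElement_def, hx, hy, mul_assoc] at hxy
  exact hxy hxy2

end SecondCohomology

section CommutatorQuotient

variable {G : Type} [Group G]

theorem commutatorElement_mem_of_commutator_quotient_le_center {N : Subgroup G} [N.Normal]
    (h : commutator (G ⧸ N) ≤ center (G ⧸ N)) {d : G} (hd : d ∈ commutator G) (g : G) :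
    ⁅d, g⁆ ∈ N := by
  rw [← QuotientGroup.eq_one_iff, ← QuotientGroup.mk'_apply, map_commutatorElement,
    commutatorElement_eq_one_iff_mul_comm]
  refine (mem_center_iff.mp (h ?_) _).symm
  have hle : commutator G ≤ (commutator (G ⧸ N)).comap (QuotientGroup.mk' N) :=
    (commutator_le (H₁ := ⊤) (H₂ := ⊤)).mpr fun x _ y _ => by
      rw [mem_comap, map_commutatorElement]
      exact commutatorElement_mem_commutator _ _
  exact hle hd

theorem le_of_lt_of_prime_relIndex {N D E : Subgroup G} (h : (N.relIndex D).Prime) (hNE : N < E)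
    (hED : E ≤ D) : D ≤ E := by
  rw [← relIndex_mul_relIndex N E D hNE.le hED, Nat.prime_mul_iff] at h
  rw [← relIndex_eq_one]
  refine (h.resolve_right fun hN => ?_).2
  exact hNE.not_ge (relIndex_eq_one.mp hN.2)

variable {p : ℕ} [hp : Fact p.Prime]

theorem commutator_le_center_of_card_commutator_eq_prime [Finite G] (hG : IsPGroup p G)
    (hp' : Nat.card (commutator G) = p) : commutator G ≤ center G := by
  obtain ⟨z, hz, -, hG'⟩ := exists_eq_zpowers_of_card_eq_prime hG hp'
  exact hG' ▸ zpowers_le.mpr hz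

theorem index_commutator_eq {n : ℕ} (hG : Nat.card G = p ^ (n + 2))
    (hk : Nat.card (commutator G) = p ^ 2) : (commutator G).index = p ^ n := by
  have h := card_mul_index (commutator G)
  rw [hk, hG, add_comm, pow_add] at h
  exact Nat.eq_of_mul_eq_mul_left (pow_pos hp.out.pos 2) h

theorem prime_relIndex_zpowers {D : Subgroup G} (hD : Nat.card D = p ^ 2) {z : G}
    (ho : orderOf z = p) (hz : z ∈ D) : ((zpowers z).relIndex D).Prime := by
  have h := relIndex_mul_relIndex ⊥ (zpowers z) D bot_le (zpowers_le.mpr hz)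
  rw [relIndex_bot_left, relIndex_bot_left, Nat.card_zpowers, ho, hD, sq] at h
  exact Nat.eq_of_mul_eq_mul_left hp.out.pos h ▸ hp.out

theorem commutatorElement_mem_zpowers [Finite G] (hG : IsPGroup p G)
    (hk : Nat.card (commutator G) = p ^ 2) {z : G} [(zpowers z).Normal] (hz : z ∈ commutator G)
    (ho : orderOf z = p) {d : G} (hd : d ∈ commutator G) (g : G) : ⁅d, g⁆ ∈ zpowers z :=
  commutatorElement_mem_of_commutator_quotient_le_center
    (commutator_le_center_of_card_commutator_eq_prime (hG.to_quotient _)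
      ((card_commutator_quotient_zpowers hk ho hz).trans (pow_one p))) hd g

theorem exists_commutatorElement_commutatorElement_ne_one {N : Subgroup G} (hN : N ≤ center G)
    (hNG : N ≤ commutator G) (hidx : (N.relIndex (commutator G)).Prime)
    (h : ¬ commutator G ≤ center G) : ∃ x y : G, ⁅⁅x, y⁆, y⁆ ≠ 1 := by
  by_contra! hc
  have hcomm (x y : G) : Commute ⁅x, y⁆ y := commutatorElement_eq_one_iff_commute.mp (hc x y)
  have hcentral {x w : G} (hw : ¬ commutator G ≤ centralizer {w}) : ⁅x, w⁆ ∈ center G := by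
    by_contra hxw
    have hle : N ≤ commutator G ⊓ centralizer {w} := le_inf hNG (hN.trans (center_le_centralizer _))
    refine hw ((le_of_lt_of_prime_relIndex hidx (hle.lt_of_ne fun he => hxw (hN ?_))
      inf_le_left).trans inf_le_right)
    rw [he]
    exact ⟨commutatorElement_mem_commutator x w, mem_centralizer_singleton_iff.mpr (hcomm x w)⟩
  refine h ((commutator_le (H₁ := ⊤) (H₂ := ⊤)).mpr fun x _ y _ => mem_center_iff.mpr fun w => ?_)
  by_cases hw : commutator G ≤ centralizer {w}
  · exact (mem_centralizer_singleton_iff.mp (hw (commutatorElement_mem_commutator x y))).symm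
  · have hxw : ⁅x, w⁆ ∈ center G := hcentral hw
    have hmul : ⁅x, y * w⁆ = ⁅x, y⁆ * ⁅x, w⁆ := by
      rw [commutatorElement_mul_right_eq_mul_conj, mul_assoc _ y, mem_center_iff.mp hxw y,
        mul_assoc, mul_assoc, mul_inv_cancel, mul_one]
    have hyw := hcomm x (y * w)
    have hxw' : Commute ⁅x, w⁆ (y * w) := (mem_center_iff.mp hxw (y * w)).symm
    have hxy : Commute ⁅x, y⁆ (y * w) := by
      simpa only [hmul, mul_inv_cancel_right] using hyw.mul_left hxw'.inv_left
    simpa only [inv_mul_cancel_left] using ((hcomm x y).inv_right.mul_right hxy).symm.eq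

end CommutatorQuotient

namespace SecondCohomology

variable {K : Type} [Field K] [IsAlgClosed K] [CharZero K] {G : Type} [Group G] [Finite G]

section PairingSurjective

variable {z : G} {hz : z ∈ center G} (htop : (pairing K hz).range = ⊤)
include htop

theorem mem_commutator_of_forall_commPairing_eq_one {w : G}
    (h : ∀ α : TwoCocycle K G, α.commPairing w z = 1) : w ∈ commutator G :=
  mem_commutator_of_forall_character (K := K) fun χ => by
    obtain ⟨α, hα⟩ := exists_eq_commPairing_of_mem_range_pairing (htop ▸ mem_top χ)
    rw [hα, h]

theorem pow_orderOf_mem_commutator (g : G) : g ^ orderOf z ∈ commutator G :=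
  mem_commutator_of_forall_character (K := K) fun χ => by
    rw [map_pow, pow_orderOf_eq_one_of_mem_range_pairing (htop ▸ mem_top χ)]

end PairingSurjective

theorem pow_le_card_quotient_mul_card_range_pairing {z : G} (hz : z ∈ center G)
    (hz' : z ∈ commutator G) {p n : ℕ} (ho : orderOf z = p)
    (hM : p ^ (n + 1).choose 2 ≤ Nat.card (SecondCohomology K G)) [(zpowers z).Normal] :
    p ^ (n.choose 2 + 1) * p ^ n ≤
      Nat.card (SecondCohomology K (G ⧸ zpowers z)) * Nat.card (pairing K hz).range :=
  calc p ^ (n.choose 2 + 1) * p ^ n = p * p ^ (n + 1).choose 2 := by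
        rw [Nat.choose_succ_succ' n 1, Nat.choose_one_right]
        ring
    _ ≤ p * Nat.card (SecondCohomology K G) := Nat.mul_le_mul_left p hM
    _ ≤ _ := ho ▸ orderOf_mul_card_le hz hz'

section CentralQuotient

variable {p n : ℕ} [hp : Fact p.Prime] (hG : Nat.card G = p ^ (n + 2))
  (hk : Nat.card (commutator G) = p ^ 2) {z : G} (hz : z ∈ center G) (hz' : z ∈ commutator G)
  (ho : orderOf z = p) (hM : p ^ (n + 1).choose 2 ≤ Nat.card (SecondCohomology K G))
include hG hk hz' ho hM

include hz in
theorem pow_le_card_quotient [(zpowers z).Normal] :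
    p ^ (n.choose 2 + 1) ≤ Nat.card (SecondCohomology K (G ⧸ zpowers z)) := by
  refine Nat.le_of_mul_le_mul_right ?_ (pow_pos hp.out.pos n)
  exact (pow_le_card_quotient_mul_card_range_pairing hz hz' ho hM).trans
    (Nat.mul_le_mul_left _ ((card_range_pairing_le_index_commutator hz).trans_eq
      (index_commutator_eq hG hk)))

theorem range_pairing_eq_top : (pairing K hz).range = ⊤ := by
  have : (zpowers z).Normal := normal_of_le_center (zpowers_le.mpr hz)
  have := finite_characters K G
  refine eq_top_of_le_card _ ?_
  rw [card_characters, index_commutator_eq hG hk]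
  refine Nat.le_of_mul_le_mul_left ?_ (pow_pos hp.out.pos (n.choose 2 + 1))
  refine (pow_le_card_quotient_mul_card_range_pairing hz hz' ho hM).trans
    (Nat.mul_le_mul_right _ (card_le_of_card_commutator_eq_prime
      (card_quotient_zpowers_of_orderOf_eq_prime hG ho) ?_))
  rw [card_commutator_quotient_zpowers hk ho hz', pow_one]

end CentralQuotient

variable {p n : ℕ} [hp : Fact p.Prime] (hG : Nat.card G = p ^ (n + 2))
  (hk : Nat.card (commutator G) = p ^ 2)
  (hM : p ^ (n + 1).choose 2 ≤ Nat.card (SecondCohomology K G))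
include hG hk hM

theorem commutator_le_center_of_card_le : commutator G ≤ center G := by
  by_contra hcen
  obtain ⟨z₀, hz₀', hz₀, ho₀⟩ := exists_mem_center_orderOf_eq_prime (IsPGroup.of_card hG)
    (ne_bot_of_card_eq_prime_pow_succ hk)
  set N := zpowers z₀
  have hNc : N ≤ center G := zpowers_le.mpr hz₀
  have hNG : N ≤ commutator G := zpowers_le.mpr hz₀'
  have : N.Normal := normal_of_le_center hNc
  have hcN {d : G} (hd : d ∈ commutator G) (g : G) : ⁅d, g⁆ ∈ N :=
    commutatorElement_mem_zpowers (IsPGroup.of_card hG) hk hz₀' ho₀ hd g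
  obtain ⟨x, y, hxy⟩ := exists_commutatorElement_commutatorElement_ne_one hNc hNG
    (prime_relIndex_zpowers hk ho₀ hz₀') hcen
  have hc := commutatorElement_mem_commutator x y
  have hzN : ⁅⁅x, y⁆, y⁆ ∈ N := hcN hc y
  have hz : ⁅⁅x, y⁆, y⁆ ∈ center G := hNc hzN
  have ho : orderOf ⁅⁅x, y⁆, y⁆ = p :=
    orderOf_eq_prime (orderOf_dvd_iff_pow_eq_one.mp
      ((orderOf_dvd_of_mem_zpowers hzN).trans ho₀.dvd)) hxy
  obtain ⟨i, hi⟩ := mem_zpowers_iff.mp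
    (zpowers_le.mpr (mem_zpowers_of_orderOf_eq_prime ho₀ hzN hxy) (hcN hc x))
  have htop := range_pairing_eq_top hG hk hz (hNG hzN) ho hM
  -- `commPairing_commutatorElement_swap` says exactly that `x` and `y ^ i` pair alike with `z`.
  have hmem : x * (y ^ i)⁻¹ ∈ commutator G :=
    mem_commutator_of_forall_commPairing_eq_one htop fun α => by
      rw [← TwoCocycle.centralPairing_apply hz, map_mul, map_inv, map_zpow,
        TwoCocycle.centralPairing_apply, TwoCocycle.centralPairing_apply, mul_inv_eq_one,
        ← TwoCocycle.commPairing_zpow_right (mem_center_iff.mp hz y), hi,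
        TwoCocycle.commPairing_commutatorElement_swap (hNc (hcN hc x)) hz]
  have hxyi : ⁅x, y⁆ = ⁅x * (y ^ i)⁻¹, y⁆ := by
    simp only [commutatorElement_def]
    group
  exact hxy (commutatorElement_eq_one_iff_commute.mpr
    (mem_center_iff.mp (hNc (hxyi ▸ hcN hmem y)) y).symm)

theorem pow_mem_commutator_of_card_commutator_eq_prime_sq (g : G) : g ^ p ∈ commutator G := by
  obtain ⟨z, hz', hz, ho⟩ := exists_mem_center_orderOf_eq_prime (IsPGroup.of_card hG)
    (ne_bot_of_card_eq_prime_pow_succ hk)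
  exact ho ▸ pow_orderOf_mem_commutator (range_pairing_eq_top hG hk hz hz' ho hM) g

end SecondCohomology

/-- The groups of class two and exponent `p` with `|G'| = p ^ 2` that are generated by an abelian
subgroup `A ⊇ G'` and one further element `a`, commuting with no element of `A` outside `G'`. -/
structure IsRankTwoType {G : Type} [Group G] (p : ℕ) (A : Subgroup G) (a : G) : Prop where
  commutator_le_center : commutator G ≤ center G
  card_commutator : Nat.card (commutator G) = p ^ 2
  pow_eq_one : ∀ g : G, g ^ p = 1
  isMulCommutative : IsMulCommutative A
  commutator_le : commutator G ≤ A
  exists_eq : ∀ g, ∃ x ∈ A, ∃ j : ℤ, g = x * a ^ j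
  notMem : a ∉ A
  mem_commutator : ∀ x ∈ A, ⁅a, x⁆ = 1 → x ∈ commutator G

section RankTwoExistence

variable {G : Type} [Group G] {p : ℕ}

theorem exists_notMem_center_of_quotient (hG : commutator G ≤ center G) {N : Subgroup G}
    [N.Normal] {a b : G} (h : IsHeisenbergType p (a : G ⧸ N) (b : G ⧸ N))
    (hab : ¬ commutator G ≤ zpowers ⁅a, b⁆) : ∃ u ∉ center G, ∀ g, ⁅u, g⁆ ∈ N := by
  by_contra! hcon
  refine hab (commutator_le_zpowers hG fun g => ?_)
  obtain ⟨c, hc, i, j, hg⟩ := h.exists_eq (g : G ⧸ N)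
  refine ⟨g * (a ^ j)⁻¹ * (b ^ i)⁻¹, ?_, i, j, by group⟩
  have hcenter : ((g * (a ^ j)⁻¹ * (b ^ i)⁻¹ : G) : G ⧸ N) ∈ center (G ⧸ N) := by
    rw [QuotientGroup.mk_mul, QuotientGroup.mk_mul, hg]
    simpa using hc
  by_contra hu
  obtain ⟨x, hx⟩ := hcon _ hu
  refine hx ((QuotientGroup.eq_one_iff _).mp ?_)
  rw [← QuotientGroup.mk'_apply, map_commutatorElement, commutatorElement_eq_one_iff_mul_comm]
  exact (mem_center_iff.mp hcenter _).symm

variable [hp : Fact p.Prime]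

theorem not_le_zpowers_of_card_eq_prime_sq {D : Subgroup G} (hD : Nat.card D = p ^ 2) {w : G}
    (hw : w ^ p = 1) : ¬ D ≤ zpowers w := fun h => by
  have hfin : Finite (zpowers w) :=
    (isOfFinOrder_iff_pow_eq_one.mpr ⟨p, hp.out.pos, hw⟩).finite_zpowers
  have hle := card_le_of_le h
  rw [hD, Nat.card_zpowers] at hle
  exact (hle.trans (orderOf_le_of_pow_eq_one hp.out.pos hw)).not_gt
    (lt_self_pow₀ hp.out.one_lt one_lt_two)

theorem eq_one_of_forall_mem_zpowers {D : Subgroup G} (hD : Nat.card D = p ^ 2)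
    (hpow : ∀ d ∈ D, d ^ p = 1) {w : G} (hwD : w ∈ D) (hw : ∀ d ∈ D, d ≠ 1 → w ∈ zpowers d) :
    w = 1 := by
  by_contra hw1
  refine not_le_zpowers_of_card_eq_prime_sq hD (hpow w hwD) fun v hv => ?_
  rcases eq_or_ne v 1 with rfl | hv1
  · exact one_mem _
  · exact mem_zpowers_of_orderOf_eq_prime (orderOf_eq_prime (hpow v hv) hv1) (hw v hv hv1) hw1

theorem exists_eq_mul_zpow_of_centralizer (hG : commutator G ≤ center G) {z u a : G}
    (hz : orderOf z = p) (hu : ∀ g, ⁅u, g⁆ ∈ zpowers z) (hua : ⁅u, a⁆ ≠ 1) (g : G) :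
    ∃ x ∈ centralizer {u}, ∃ j : ℤ, g = x * a ^ j := by
  obtain ⟨j, hj⟩ := mem_zpowers_iff.mp
    (zpowers_le.mpr (mem_zpowers_of_orderOf_eq_prime hz (hu a) hua) (hu g))
  refine ⟨g * (a ^ j)⁻¹, ?_, j, (inv_mul_cancel_right g (a ^ j)).symm⟩
  rw [mem_centralizer_singleton_iff, eq_comm, ← commutatorElement_eq_one_iff_mul_comm,
    ← commutatorHom_apply hG, map_mul, map_inv, map_zpow, commutatorHom_apply,
    commutatorHom_apply, hj, mul_inv_cancel]

theorem isRankTwoType_centralizer (hG : commutator G ≤ center G)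
    (hk : Nat.card (commutator G) = p ^ 2) (hexp : ∀ g : G, g ^ p = 1)
    (hsep : ∀ x y w : G, ⁅x, y⁆ ≠ 1 → Commute y w → Commute w x → w ∈ commutator G) {z u a : G}
    (hz : orderOf z = p) (hu : ∀ g, ⁅u, g⁆ ∈ zpowers z) (hua : ⁅u, a⁆ ≠ 1) :
    IsRankTwoType p (centralizer {u}) a where
  commutator_le_center := hG
  card_commutator := hk
  pow_eq_one := hexp
  isMulCommutative := ⟨⟨fun x y => Subtype.ext <| by
    by_contra hxy
    have huG : u ∈ commutator G := hsep x y u (mt commutatorElement_eq_one_iff_mul_comm.mp hxy)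
      (mem_centralizer_singleton_iff.mp y.2) (mem_centralizer_singleton_iff.mp x.2).symm
    exact hua (commutatorElement_eq_one_iff_mul_comm.mpr (mem_center_iff.mp (hG huG) a).symm)⟩⟩
  commutator_le := hG.trans (center_le_centralizer _)
  exists_eq := exists_eq_mul_zpow_of_centralizer hG hz hu hua
  notMem ha := hua (commutatorElement_eq_one_iff_mul_comm.mpr
    (mem_centralizer_singleton_iff.mp ha).symm)
  mem_commutator x hx hax := by
    refine hsep u a x hua (commutatorElement_eq_one_iff_commute.mp hax) ?_
    exact mem_centralizer_singleton_iff.mp hx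

end RankTwoExistence

namespace SecondCohomology

variable {K : Type} [Field K] [IsAlgClosed K] [CharZero K] {G : Type} [Group G] [Finite G]
  {p n : ℕ} [hp : Fact p.Prime] (hG : Nat.card G = p ^ (n + 2))
  (hk : Nat.card (commutator G) = p ^ 2)
  (hM : p ^ (n + 1).choose 2 ≤ Nat.card (SecondCohomology K G))
include hG hk hM

theorem pow_eq_one_on_commutator_of_card_le {d : G} (hd : d ∈ commutator G) : d ^ p = 1 :=
  have hcen := commutator_le_center_of_card_le hG hk hM
  pow_eq_one_of_mem_commutator hcen
    (fun x => hcen (pow_mem_commutator_of_card_commutator_eq_prime_sq hG hk hM x)) hd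

theorem mem_commutator_of_commute_of_card_le {x y w : G} (hxy : ⁅x, y⁆ ≠ 1) (hyw : Commute y w)
    (hwx : Commute w x) : w ∈ commutator G := by
  have hcen := commutator_le_center_of_card_le hG hk hM
  have hd := commutatorElement_mem_commutator x y
  have ho := orderOf_eq_prime (pow_eq_one_on_commutator_of_card_le hG hk hM hd) hxy
  refine mem_commutator_of_forall_commPairing_eq_one
    (range_pairing_eq_top hG hk (hcen hd) hd ho hM) fun α => ?_
  have hyw' := commutatorElement_eq_one_iff_commute.mpr hyw
  have hwx' := commutatorElement_eq_one_iff_commute.mpr hwx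
  have hjacobi := α.commPairing_jacobi (hcen hd) (hyw' ▸ one_mem _) (hwx' ▸ one_mem _)
  rwa [hyw', hwx', TwoCocycle.commPairing_one_right, TwoCocycle.commPairing_one_right, mul_one,
    mul_one] at hjacobi

section CentralQuotient

variable {z : G} [(zpowers z).Normal] (hz' : z ∈ commutator G) (hz1 : z ≠ 1)
include hz' hz1

theorem exists_isHeisenbergType_quotient_of_card_le : p ≠ 2 ∧
    ∃ a b : G, IsHeisenbergType p (a : G ⧸ zpowers z) (b : G ⧸ zpowers z) := by
  have ho := orderOf_eq_prime (pow_eq_one_on_commutator_of_card_le hG hk hM hz') hz1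
  have hQ := card_quotient_zpowers_of_orderOf_eq_prime hG ho
  have hkQ := (card_commutator_quotient_zpowers hk ho hz').trans (pow_one p)
  have hMQ := pow_le_card_quotient hG hk (commutator_le_center_of_card_le hG hk hM hz') hz' ho hM
  refine ⟨ne_two_of_card_le hQ hkQ hMQ, ?_⟩
  obtain ⟨a, b, h⟩ := exists_isHeisenbergType_of_card_le hQ hkQ
    ((Nat.pow_le_pow_right hp.out.pos (Nat.le_succ _)).trans hMQ)
  obtain ⟨a, rfl⟩ := QuotientGroup.mk_surjective a
  obtain ⟨b, rfl⟩ := QuotientGroup.mk_surjective b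
  exact ⟨a, b, h⟩

theorem pow_mem_zpowers_of_card_le (g : G) : g ^ p ∈ zpowers z := by
  obtain ⟨hp2, a, b, h⟩ := exists_isHeisenbergType_quotient_of_card_le hG hk hM hz' hz1
  rw [← QuotientGroup.eq_one_iff, QuotientGroup.mk_pow]
  exact h.pow_eq_one_of_ne_two hp2 _

end CentralQuotient

theorem pow_eq_one_of_card_le (g : G) : g ^ p = 1 := by
  refine eq_one_of_forall_mem_zpowers hk (fun d => pow_eq_one_on_commutator_of_card_le hG hk hM)
    (pow_mem_commutator_of_card_commutator_eq_prime_sq hG hk hM g) fun z hz' hz1 => ?_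
  have : (zpowers z).Normal :=
    normal_of_le_center (zpowers_le.mpr (commutator_le_center_of_card_le hG hk hM hz'))
  exact pow_mem_zpowers_of_card_le hG hk hM hz' hz1 g

theorem exists_isRankTwoType_of_card_le : ∃ (A : Subgroup G) (a : G), IsRankTwoType p A a := by
  have hcen := commutator_le_center_of_card_le hG hk hM
  have hexp := pow_eq_one_of_card_le hG hk hM
  obtain ⟨z, hz', hz, ho⟩ := exists_mem_center_orderOf_eq_prime (IsPGroup.of_card hG)
    (ne_bot_of_card_eq_prime_pow_succ hk)
  have : (zpowers z).Normal := normal_of_le_center (zpowers_le.mpr hz)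
  have hz1 : z ≠ 1 := fun h => hp.out.ne_one (ho.symm.trans (orderOf_eq_one_iff.mpr h))
  obtain ⟨-, a₀, b₀, hH⟩ := exists_isHeisenbergType_quotient_of_card_le hG hk hM hz' hz1
  obtain ⟨u, hu, huz⟩ := exists_notMem_center_of_quotient hcen hH
    (not_le_zpowers_of_card_eq_prime_sq hk (hexp _))
  obtain ⟨a, ha⟩ : ∃ a : G, ⁅u, a⁆ ≠ 1 := by
    by_contra! h
    exact hu (mem_center_iff.mpr fun g => (commutatorElement_eq_one_iff_mul_comm.mp (h g)).symm)
  exact ⟨centralizer {u}, a, isRankTwoType_centralizer hcen hk hexp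
    (fun _ _ _ => mem_commutator_of_commute_of_card_le hG hk hM) ho huz ha⟩

end SecondCohomology

section KernelEqRange

variable {F V W : Type} [Field F] [AddCommGroup V] [AddCommGroup W] [Module F V] [Module F W]

theorem exists_linearEquiv_range_prod_range (T : V →ₗ[F] V)
    (hT : LinearMap.ker T = LinearMap.range T) :
    ∃ Φ : (LinearMap.range T × LinearMap.range T) ≃ₗ[F] V, ∀ x y, T (Φ (x, y)) = Φ (y, 0) := by
  obtain ⟨s, hs⟩ := T.rangeRestrict.exists_rightInverse_of_surjective T.range_rangeRestrict
  have hTs (y : LinearMap.range T) : T (s y) = y :=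
    congrArg Subtype.val (LinearMap.congr_fun hs y)
  have hT0 (x : LinearMap.range T) : T x = 0 := LinearMap.mem_ker.mp (hT.ge x.2)
  let Φ := (LinearMap.range T).subtype.coprod s
  have hTΦ (x y : LinearMap.range T) : T (Φ (x, y)) = y := by
    simp only [Φ, LinearMap.coprod_apply, Submodule.subtype_apply, map_add, hT0, hTs, zero_add]
  have hΦ0 (x : LinearMap.range T) : Φ (x, 0) = x := by
    simp only [Φ, LinearMap.coprod_apply, Submodule.subtype_apply, map_zero, add_zero]
  refine ⟨LinearEquiv.ofBijective Φ ⟨?_, fun v => ?_⟩, fun x y => (hTΦ x y).trans (hΦ0 y).symm⟩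
  · rw [← LinearMap.ker_eq_bot, LinearMap.ker_eq_bot']
    rintro ⟨x, y⟩ h
    have hy : y = 0 := Subtype.ext ((hTΦ x y).symm.trans (h ▸ map_zero T))
    subst hy
    exact Prod.ext (Subtype.ext ((hΦ0 x).symm.trans h)) rfl
  · have hmem : v - s (T.rangeRestrict v) ∈ LinearMap.range T := by
      refine hT.le (LinearMap.mem_ker.mpr ?_)
      rw [map_sub, hTs]
      exact sub_self (T v)
    exact ⟨(⟨_, hmem⟩, T.rangeRestrict v), sub_add_cancel _ _⟩

theorem exists_linearEquiv_semiconj [Finite F] [Finite V] [Finite W] (T : V →ₗ[F] V)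
    (S : W →ₗ[F] W) (hT : LinearMap.ker T = LinearMap.range T)
    (hS : LinearMap.ker S = LinearMap.range S)
    (hc : Nat.card (LinearMap.range T) = Nat.card (LinearMap.range S)) :
    ∃ e : V ≃ₗ[F] W, ∀ v, e (T v) = S (e v) := by
  obtain ⟨σ⟩ := nonempty_linearEquiv_of_card_eq (F := F) hc
  obtain ⟨Φ, hΦ⟩ := exists_linearEquiv_range_prod_range T hT
  obtain ⟨Ψ, hΨ⟩ := exists_linearEquiv_range_prod_range S hS
  refine ⟨Φ.symm.trans ((σ.prodCongr σ).trans Ψ), fun v => ?_⟩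
  obtain ⟨⟨x, y⟩, rfl⟩ := Φ.surjective v
  simp only [hΦ, LinearEquiv.trans_apply, LinearEquiv.symm_apply_apply, LinearEquiv.prodCongr_apply,
    hΨ, map_zero]

theorem exists_mulEquiv_semiconj {p : ℕ} [Fact p.Prime] {A B : Type} [CommGroup A] [CommGroup B]
    [Finite A] [Finite B] (hA : ∀ a : A, a ^ p = 1) (hB : ∀ b : B, b ^ p = 1) (T : A →* A)
    (S : B →* B) (hT : T.ker = T.range) (hS : S.ker = S.range)
    (hc : Nat.card T.range = Nat.card S.range) : ∃ e : A ≃* B, ∀ x, e (T x) = S (e x) := by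
  let _ : Module (ZMod p) (Additive A) := AddCommGroup.zmodModule fun x => hA x.toMul
  let _ : Module (ZMod p) (Additive B) := AddCommGroup.zmodModule fun x => hB x.toMul
  obtain ⟨e, he⟩ := exists_linearEquiv_semiconj (T.toAdditive.toZModLinearMap p)
    (S.toAdditive.toZModLinearMap p) (by ext x; exact SetLike.ext_iff.mp hT x.toMul)
    (by ext x; exact SetLike.ext_iff.mp hS x.toMul) hc
  exact ⟨MulEquiv.toAdditive.symm e.toAddEquiv, he⟩

end KernelEqRange

namespace IsRankTwoType

variable {G : Type} [Group G] {p : ℕ} {A : Subgroup G} {a : G} (h : IsRankTwoType p A a)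

/-- The commutator map `⁅a, ·⁆` as an endomorphism of `A`. -/
def commutatorEnd : A →* A :=
  ((commutatorHom h.commutator_le_center a).comp A.subtype).codRestrict A fun _ =>
    h.commutator_le (commutatorElement_mem_commutator _ _)

theorem coe_commutatorEnd (x : A) : (h.commutatorEnd x : G) = ⁅a, (x : G)⁆ := rfl

include h

theorem commutatorElement_mul_zpow (g x : G) (j : ℤ) : ⁅g, x * a ^ j⁆ = ⁅g, x⁆ * ⁅g, a⁆ ^ j := by
  simp only [← commutatorHom_apply h.commutator_le_center, map_mul, map_zpow]

theorem commutator_le_map_commutatorHom :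
    commutator G ≤ A.map (commutatorHom h.commutator_le_center a) := by
  have ha (g : G) : ⁅a, g⁆ ∈ A.map (commutatorHom h.commutator_le_center a) := by
    obtain ⟨x, hx, j, rfl⟩ := h.exists_eq g
    rw [h.commutatorElement_mul_zpow, commutatorElement_self, one_zpow, mul_one]
    exact mem_map_of_mem _ hx
  have ha' (g : G) : ⁅g, a⁆ ∈ A.map (commutatorHom h.commutator_le_center a) :=
    commutatorElement_inv a g ▸ inv_mem (ha g)
  have hA {x : G} (hx : x ∈ A) (g : G) :
      ⁅x, g⁆ ∈ A.map (commutatorHom h.commutator_le_center a) := by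
    obtain ⟨y, hy, j, rfl⟩ := h.exists_eq g
    have hxy : ⁅x, y⁆ = 1 := commutatorElement_eq_one_iff_mul_comm.mpr
      (congrArg Subtype.val (h.isMulCommutative.is_comm.comm ⟨x, hx⟩ ⟨y, hy⟩))
    rw [h.commutatorElement_mul_zpow, hxy, one_mul]
    exact zpow_mem (ha' x) j
  refine (Subgroup.commutator_le (H₁ := ⊤) (H₂ := ⊤)).mpr fun g _ g' _ => ?_
  obtain ⟨x, hx, j, rfl⟩ := h.exists_eq g'
  rw [h.commutatorElement_mul_zpow]
  exact mul_mem (commutatorElement_inv x g ▸ inv_mem (hA hx g)) (zpow_mem (ha' g) j)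

theorem ker_commutatorEnd : h.commutatorEnd.ker = (commutator G).subgroupOf A := by
  ext x
  rw [MonoidHom.mem_ker, mem_subgroupOf, Subtype.ext_iff, coe_commutatorEnd, coe_one]
  refine ⟨h.mem_commutator x x.2, fun hx => commutatorElement_eq_one_iff_mul_comm.mpr ?_⟩
  exact mem_center_iff.mp (h.commutator_le_center hx) a

theorem range_commutatorEnd : h.commutatorEnd.range = (commutator G).subgroupOf A := by
  ext x
  constructor
  · rintro ⟨y, rfl⟩
    exact commutatorElement_mem_commutator a _
  · intro hx
    obtain ⟨y, hy, hyx⟩ := h.commutator_le_map_commutatorHom hx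
    exact ⟨⟨y, hy⟩, Subtype.ext hyx⟩

theorem card_range_commutatorEnd : Nat.card h.commutatorEnd.range = p ^ 2 := by
  rw [range_commutatorEnd, Nat.card_congr (subgroupOfEquivOfLe h.commutator_le).toEquiv,
    h.card_commutator]

theorem mul_zpow_mul_mul_zpow (x y : A) (i j : ℤ) :
    ((x : G) * a ^ i) * ((y : G) * a ^ j) =
      ((x * h.commutatorEnd y ^ i * y : A) : G) * a ^ (i + j) := by
  have hay : a ^ i * y = ⁅a, (y : G)⁆ ^ i * (y * a ^ i) := by
    rw [mul_eq_commutatorElement_mul, commutatorElement_zpow_left h.commutator_le_center]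
  calc _ = (x : G) * (a ^ i * y) * a ^ j := by simp only [mul_assoc]
    _ = _ := by
      rw [hay, zpow_add]
      simp only [Subgroup.coe_mul, Subgroup.coe_zpow, coe_commutatorEnd, mul_assoc]

variable [hp : Fact p.Prime]

theorem mul_zpow_eq_one_iff (x : A) (i : ℤ) : (x : G) * a ^ i = 1 ↔ x = 1 ∧ (p : ℤ) ∣ i := by
  have ho : orderOf a = p :=
    orderOf_eq_prime (h.pow_eq_one a) fun ha => h.notMem (ha ▸ one_mem A)
  constructor
  · intro hx
    have hai : a ^ i = 1 := by
      by_contra hai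
      refine h.notMem (zpowers_le.mpr ?_
        (mem_zpowers_of_orderOf_eq_prime ho (zpow_mem (mem_zpowers a) i) hai))
      exact inv_eq_of_mul_eq_one_right hx ▸ inv_mem x.2
    rw [hai, mul_one] at hx
    exact ⟨Subtype.ext hx, ho ▸ orderOf_dvd_iff_zpow_eq_one.mpr hai⟩
  · rintro ⟨rfl, hi⟩
    rw [coe_one, one_mul, orderOf_dvd_iff_zpow_eq_one.mp (ho.symm ▸ hi)]

open scoped IsMulCommutative in
theorem nonempty_mulEquiv [Finite G] {H : Type} [Group H] [Finite H] {B : Subgroup H} {b : H}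
    (h' : IsRankTwoType p B b) : Nonempty (G ≃* H) := by
  have := h.isMulCommutative
  have := h'.isMulCommutative
  obtain ⟨θ, hθ⟩ := exists_mulEquiv_semiconj (fun x : A => Subtype.ext (h.pow_eq_one x))
    (fun y : B => Subtype.ext (h'.pow_eq_one y)) h.commutatorEnd h'.commutatorEnd
    (h.ker_commutatorEnd.trans h.range_commutatorEnd.symm)
    (h'.ker_commutatorEnd.trans h'.range_commutatorEnd.symm)
    (h.card_range_commutatorEnd.trans h'.card_range_commutatorEnd.symm)
  refine nonempty_mulEquiv_of_parametrization (X := A × ℤ) (f := fun x => (x.1 : G) * a ^ x.2)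
    (f' := fun x => (θ x.1 : H) * b ^ x.2) ?_ ?_ ?_ fun x => ?_
  · intro g
    obtain ⟨x, hx, i, rfl⟩ := h.exists_eq g
    exact ⟨(⟨x, hx⟩, i), rfl⟩
  · intro g
    obtain ⟨y, hy, i, rfl⟩ := h'.exists_eq g
    exact ⟨(θ.symm ⟨y, hy⟩, i), by simp only [θ.apply_symm_apply]⟩
  · rintro ⟨x, i⟩ ⟨y, j⟩
    refine ⟨(x * h.commutatorEnd y ^ i * y, i + j), (h.mul_zpow_mul_mul_zpow x y i j).symm, ?_⟩
    rw [h'.mul_zpow_mul_mul_zpow, ← hθ, map_mul, map_mul, map_zpow]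
  · rw [h.mul_zpow_eq_one_iff, h'.mul_zpow_eq_one_iff, map_eq_one_iff θ θ.injective]

end IsRankTwoType

theorem HasGeneralizedCorank.pow_choose_le {p n : ℕ} (hp : p.Prime) (hn : n ≠ 0) {G : Type}
    [Group G] {s : ℤ} (hs : s ≤ 1) (h : HasGeneralizedCorank p n G s) :
    p ^ (n - 1).choose 2 ≤ Nat.card (SecondCohomology ℂ G) := by
  obtain ⟨n, rfl⟩ := Nat.exists_eq_succ_of_ne_zero hn
  have hexp : (((n + 1 : ℕ) : ℤ) - 1) * (((n + 1 : ℕ) : ℤ) - 2) / 2 = (n.choose 2 : ℤ) := by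
    rcases n with _ | n
    · rfl
    · rw [Nat.choose_two_right]
      push_cast
      congr 1
      ring
  have hle : ((p ^ n.choose 2 : ℕ) : ℚ) ≤ (Nat.card (SecondCohomology ℂ G) : ℚ) := by
    rw [HasGeneralizedCorank, hexp] at h
    rw [h, Nat.cast_pow, ← zpow_natCast]
    exact zpow_le_zpow_right₀ (by exact_mod_cast hp.one_le) (by lia)
  exact_mod_cast hle

section Extremal

variable {K : Type} [Field K] [IsAlgClosed K] [CharZero K] {G H : Type} [Group G] [Group H] {p : ℕ}

theorem SecondCohomology.le_one_of_card_le [Fact p.Prime] {n k : ℕ} (hG : Nat.card G = p ^ (n + 1))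
    (hk : Nat.card (commutator G) = p ^ (k + 1))
    (hM : p ^ n.choose 2 ≤ Nat.card (SecondCohomology K G)) : k ≤ 1 := by
  have hle := (Nat.mul_le_mul_left (p ^ k) hM).trans (pow_mul_card_le_of_card_commutator hG hk)
  rw [← pow_add, Nat.pow_le_pow_iff_right (Fact.out : p.Prime).one_lt] at hle
  lia

theorem SecondCohomology.nonempty_mulEquiv_of_card_le [hp : Fact p.Prime] {n k : ℕ}
    (hG : Nat.card G = p ^ (n + 1)) (hH : Nat.card H = p ^ (n + 1))
    (hkG : Nat.card (commutator G) = p ^ (k + 1)) (hkH : Nat.card (commutator H) = p ^ (k + 1))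
    (hMG : p ^ n.choose 2 ≤ Nat.card (SecondCohomology K G))
    (hMH : p ^ n.choose 2 ≤ Nat.card (SecondCohomology K H)) : Nonempty (G ≃* H) := by
  have : Finite G := Nat.finite_of_card_ne_zero (hG ▸ pow_ne_zero _ hp.out.ne_zero)
  have : Finite H := Nat.finite_of_card_ne_zero (hH ▸ pow_ne_zero _ hp.out.ne_zero)
  obtain rfl | rfl := Nat.le_one_iff_eq_zero_or_eq_one.mp (le_one_of_card_le hG hkG hMG)
  · rw [zero_add, pow_one] at hkG hkH
    obtain ⟨a, b, h⟩ := exists_isHeisenbergType_of_card_le hG hkG hMG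
    obtain ⟨c, d, h'⟩ := exists_isHeisenbergType_of_card_le hH hkH hMH
    exact h.nonempty_mulEquiv h' (hG.trans hH.symm)
  · have hn : 2 ≤ n + 1 := (Nat.pow_dvd_pow_iff_le_right hp.out.one_lt).mp
      (hkG ▸ hG ▸ card_subgroup_dvd_card (commutator G))
    obtain ⟨n, rfl⟩ := Nat.exists_eq_succ_of_ne_zero (show n ≠ 0 by lia)
    obtain ⟨A, a, h⟩ := exists_isRankTwoType_of_card_le hG hkG hMG
    obtain ⟨B, b, h'⟩ := exists_isRankTwoType_of_card_le hH hkH hMH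
    exact h.nonempty_mulEquiv h'

theorem exists_card_commutator_eq_pow_succ (hp : p.Prime) {n : ℕ} (hG : Nat.card G = p ^ n)
    (hnonab : ¬ ∀ a b : G, a * b = b * a) : ∃ k, Nat.card (commutator G) = p ^ (k + 1) := by
  obtain ⟨_ | k, -, hk⟩ :=
    (Nat.dvd_prime_pow hp).mp (hG ▸ card_subgroup_dvd_card (commutator G))
  · rw [pow_zero, card_eq_one, commutator_eq_bot_iff] at hk
    exact absurd hk.is_comm.comm hnonab
  · exact ⟨k, hk⟩

theorem ne_zero_of_card_eq_pow {n : ℕ} (hG : Nat.card G = p ^ n)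
    (hnonab : ¬ ∀ a b : G, a * b = b * a) : n ≠ 0 := by
  rintro rfl
  have := (Nat.card_eq_one_iff_unique.mp hG).1
  exact hnonab fun a b => Subsingleton.elim _ _

theorem mainTheorem3_general {n : ℕ} (hp : p.Prime) (hG : Nat.card G = p ^ n)
    (hnonab : ¬ ∀ a b : G, a * b = b * a)
    (hM : p ^ (n - 1).choose 2 ≤ Nat.card (SecondCohomology K G)) (hH : Nat.card H = p ^ n) :
    TwistIsomorphic K G H ↔ Nonempty (G ≃* H) := by
  refine ⟨fun h => ?_, fun ⟨f⟩ => TwistIsomorphic.of_mulEquiv K f⟩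
  have : Fact p.Prime := ⟨hp⟩
  have : Finite G := Nat.finite_of_card_ne_zero (hG ▸ pow_ne_zero _ hp.ne_zero)
  have : Finite H := Nat.finite_of_card_ne_zero (hH ▸ pow_ne_zero _ hp.ne_zero)
  obtain ⟨k, hk⟩ := exists_card_commutator_eq_pow_succ hp hG hnonab
  obtain ⟨n, rfl⟩ := Nat.exists_eq_succ_of_ne_zero (ne_zero_of_card_eq_pow hG hnonab)
  exact SecondCohomology.nonempty_mulEquiv_of_card_le hG hH hk
    (h.card_commutator_eq (hG.trans hH.symm) ▸ hk) hM (h.card_secondCohomology_eq ▸ hM)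

end Extremal
end

theorem mainTheorem3 (p n : ℕ) (hp : p.Prime) (G : Type) [Group G]
    (hcard : Nat.card G = p ^ n) (hnonab : ¬ ∀ a b : G, a * b = b * a)
    (s : ℤ) (hs : s = 0 ∨ s = 1) (hG : HasGeneralizedCorank p n G s)
    (H : Type) [Group H] (hH : Nat.card H = p ^ n) :
    TwistIsomorphic ℂ G H ↔ Nonempty (G ≃* H) :=
  mainTheorem3_general hp hcard hnonab
    (hG.pow_choose_le hp (ne_zero_of_card_eq_pow hcard hnonab) (by lia)) hH
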